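/- **Theorem (Finiteness of the limiting density).** Let $d>1$ be squarefree, let $\Delta$ be the discriminant of $\mathbb{Q}(\sqrt d)$ (so $\Delta=d$ if $d\equiv 1 \bmod 4$ and $\Delta=4d$ otherwise), and let $\chi_d=(\Delta/\cdot)$ be the Kronecker symbol. Let $F$ be $L(s,\chi_d)$ or the Riemann zeta function $\zeta(s)$. Let $0<\gamma_1<\gamma_2<\dots$ be the distinct positive ordinates of the zeros of $F$ in the strip $0<\operatorname{Re}s<1$, and let $b_k=\sum_\rho m(\rho)\,w(\rho)$, the sum being over the zeros $\rho=\beta+i\gamma_k$ of $F$ in this strip with ordinate $\gamma_k$, where $m(\rho)$ is the multiplicity and $$w(\beta+i\gamma)=\frac{2(\beta(1-\beta)+\gamma^2)}{(\beta(1-\beta)+\gamma^2)^2+4\gamma^2(\tfrac12-\beta)^2}$$ (so $w(\tfrac12+i\gamma)=2/(\tfrac14+\gamma^2)$). Put $$S_F(\delta)=\sum_{k\ge1}b_k\cos(\gamma_k\delta),\qquad S_F^{(M)}(\delta)=\sum_{k=1}^{M}b_k\cos(\gamma_k\delta).$$ The Cesàro distribution of a function $S:\mathbb{R}\to\mathbb{R}$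 is the probability measure $\mu$ on $\mathbb{R}$ with $\lim_{T\to\infty}\frac1{2T}\int_{-T}^{T}g(S(\delta))\,d\delta=\int g\,d\mu$ for all bounded continuous $g$, if it exists. The resonance lattice of $F$ is the group $\Lambda_\infty$ of finitely supported integer sequences $(n_k)_{k\ge1}$ with $\sum_k n_k\gamma_k=0$. Assume that $\Lambda_\infty$ has finite rank. Then $\sum_k b_k<\infty$, and $S_F$ and all $S_F^{(M)}$ have Cesàro distributions; let $\varphi$ and $\varphi_M$ be their characteristic functions. The distribution of $S_F$ has a continuous density $f$ with respect to Lebesgue measure, so that its density at the origin $f(0)$ is finite. There is $M_0$, which can be taken to be at most $3$ if $\Lambda_\infty=0$, such that for all $M\ge M_0$ the function $\varphi_M$ is integrable and the distribution of $S_F^{(M)}$ has a continuous density $f_M$. Moreover $\varphi$ is integrable, $\varphi_M\to\varphi$ in $L^1(\mathbb{R})$, and $$f(0)=\frac1{2\pi}\int_{\mathbb{R}}\varphi(t)\,dt=\lim_{M\to\infty}f_M(0).$$ Thus the conclusion holds for $S_L=S_{L(\cdot,\chi_d)}$ if the resonance lattice of $L(s,\chi_d)$ has finite rank, and for $S_\zeta$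 if the resonance lattice of $\zeta(s)$ has finite rank. -/

import Mathlib

open MeasureTheory Filter Topology
open scoped BoundedContinuousFunction

noncomputable section

/-! ### The quadratic character of a real quadratic field -/

/-- The Kronecker symbol `(a / n)` for `a : ℤ` and `n : ℕ`: the Jacobi symbol for odd `n`,
extended to `n ≠ 0` by multiplicativity and `(a / 2) = 0, 1, -1` according as `a` is even,
`a ≡ ±1 (mod 8)`, `a ≡ ±3 (mod 8)`; and `(a / 0) = 1` if `a = ±1`, `(a / 0) = 0` otherwise. -/
def kroneckerSym (a : ℤ) (n : ℕ) : ℤ :=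
  if n = 0 then (if a.natAbs = 1 then 1 else 0)
  else ZMod.χ₈ (a : ZMod 8) ^ padicValNat 2 n * jacobiSym a (n / 2 ^ padicValNat 2 n)

/-- The discriminant of `ℚ(√d)`, for a squarefree natural number `d > 1`. -/
def quadDisc (d : ℕ) : ℕ := if d % 4 = 1 then d else 4 * d

instance quadDisc.instNeZero (d : ℕ) [NeZero d] : NeZero (quadDisc d) :=
  ⟨by have := NeZero.ne d; unfold quadDisc; split_ifs <;> omega⟩

theorem kroneckerSym_odd_part (n : ℕ) (hn : n ≠ 0) : Odd (n / 2 ^ padicValNat 2 n) := by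
  rw [← Nat.not_even_iff_odd, even_iff_two_dvd, ← Nat.factorization_def n Nat.prime_two]
  exact Nat.not_dvd_ordCompl Nat.prime_two hn

theorem kroneckerSym_of_mod_four_eq_one (d : ℕ) (hd : d % 4 = 1) (n : ℕ) :
    kroneckerSym d n = jacobiSym n d := by
  rcases eq_or_ne n 0 with rfl | hn
  · rcases eq_or_ne d 1 with rfl | h1
    · simp [kroneckerSym]
    · have : 1 < d := by omega
      simp [kroneckerSym, h1, jacobiSym.zero_left this]
  · have hodd : Odd d := by rw [Nat.odd_iff]; omega
    have hsplit : n = 2 ^ padicValNat 2 n * (n / 2 ^ padicValNat 2 n) :=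
      (Nat.mul_div_cancel' pow_padicValNat_dvd).symm
    have h2 : jacobiSym n d
        = jacobiSym 2 d ^ padicValNat 2 n * jacobiSym (n / 2 ^ padicValNat 2 n : ℕ) d := by
      rw [← jacobiSym.pow_left, ← jacobiSym.mul_left]
      congr 1
      exact_mod_cast hsplit
    rw [h2, jacobiSym.at_two hodd, kroneckerSym, if_neg hn,
      jacobiSym.quadratic_reciprocity_one_mod_four' (kroneckerSym_odd_part n hn) hd]
    simp

theorem kroneckerSym_four_mul (d : ℕ) (n : ℕ) :
    kroneckerSym (4 * d : ℕ) n = if n % 2 = 1 then jacobiSym d n else 0 := by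
  have h8 : ZMod.χ₈ (((4 * d : ℕ) : ℤ) : ZMod 8) = 0 := by
    have key : ∀ x : ZMod 8, ZMod.χ₈ (4 * x) = 0 := by decide
    simpa using key d
  rcases eq_or_ne n 0 with rfl | hn
  · have h1 : ¬ (((4 * d : ℕ) : ℤ).natAbs = 1) := by omega
    rw [kroneckerSym, if_pos rfl, if_neg h1, if_neg (by omega)]
  · rw [kroneckerSym, if_neg hn, h8]
    split_ifs with h
    · have h0 : padicValNat 2 n = 0 := padicValNat.eq_zero_of_not_dvd (by omega)
      have hodd : Odd n := Nat.odd_iff.2 h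
      rw [h0]
      push_cast
      rw [jacobiSym.mul_left]
      simp [jacobiSym.at_four hodd]
    · have h0 : padicValNat 2 n ≠ 0 := by
        have : 1 ≤ padicValNat 2 n := one_le_padicValNat_of_dvd hn (by omega)
        omega
      simp [h0]

theorem kroneckerSym_quadDisc_one (d : ℕ) : kroneckerSym (quadDisc d) 1 = 1 := by
  simp [kroneckerSym]

theorem kroneckerSym_quadDisc_mul (d m n : ℕ) : kroneckerSym (quadDisc d) (m * n)
    = kroneckerSym (quadDisc d) m * kroneckerSym (quadDisc d) n := by
  unfold quadDisc
  split_ifs with h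
  · simp only [kroneckerSym_of_mod_four_eq_one d h]
    push_cast
    rw [jacobiSym.mul_left]
  · simp only [kroneckerSym_four_mul]
    rcases Nat.mod_two_eq_zero_or_one m with hm | hm <;>
      rcases Nat.mod_two_eq_zero_or_one n with hn | hn <;> simp [hm, hn, Nat.mul_mod]
    exact jacobiSym.mul_right' _ (by omega) (by omega)

theorem kroneckerSym_quadDisc_mod (d n : ℕ) :
    kroneckerSym (quadDisc d) (n % quadDisc d) = kroneckerSym (quadDisc d) n := by
  unfold quadDisc
  split_ifs with h
  · simp only [kroneckerSym_of_mod_four_eq_one d h]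
    push_cast
    rw [← jacobiSym.mod_left]
  · simp only [kroneckerSym_four_mul]
    have h2 : n % (4 * d) % 2 = n % 2 := Nat.mod_mod_of_dvd n (by omega)
    rw [h2]
    split_ifs with hn
    · exact (jacobiSym.mod_right' d (Nat.odd_iff.2 hn)).symm
    · rfl

theorem kroneckerSym_quadDisc_eq_zero (d n : ℕ) (hd : d ≠ 0) (h : ¬ n.Coprime (quadDisc d)) :
    kroneckerSym (quadDisc d) n = 0 := by
  unfold quadDisc at *
  split_ifs at * with h4
  · rw [kroneckerSym_of_mod_four_eq_one d h4, jacobiSym.eq_zero_iff]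
    exact ⟨hd, by simpa [Nat.Coprime] using h⟩
  · rw [kroneckerSym_four_mul]
    split_ifs with hn
    · rw [jacobiSym.eq_zero_iff]
      refine ⟨by omega, fun hg => h ?_⟩
      have h1 : n.Coprime d := by
        rw [Nat.coprime_comm]; simpa [Nat.Coprime] using hg
      have h2 : n.Coprime 4 :=
        (Nat.Coprime.pow_right 2 (Nat.coprime_two_right.2 (Nat.odd_iff.2 hn)) : n.Coprime (2 ^ 2))
      exact h2.mul_right h1
    · rfl

/-- The quadratic character `χ_d` of `ℚ(√d)`: the Dirichlet character modulo the discriminant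
`Δ` of `ℚ(√d)` whose value at `n` is the Kronecker symbol `(Δ / n)`. -/
def quadChar (d : ℕ) [NeZero d] : DirichletCharacter ℂ (quadDisc d) where
  toFun a := (kroneckerSym (quadDisc d) a.val : ℂ)
  map_one' := by
    rw [← Nat.cast_one (R := ZMod (quadDisc d)), ZMod.val_natCast, kroneckerSym_quadDisc_mod,
      kroneckerSym_quadDisc_one, Int.cast_one]
  map_mul' a b := by
    rw [ZMod.val_mul, kroneckerSym_quadDisc_mod, kroneckerSym_quadDisc_mul, Int.cast_mul]
  map_nonunit' a ha := by
    rw [kroneckerSym_quadDisc_eq_zero d _ (NeZero.ne d), Int.cast_zero]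
    intro hc
    refine ha ?_
    rw [← ZMod.natCast_zmod_val a]
    exact (ZMod.isUnit_iff_coprime _ _).2 hc

theorem quadChar_apply_nat (d : ℕ) [NeZero d] (n : ℕ) :
    quadChar d (n : ZMod (quadDisc d)) = (kroneckerSym (quadDisc d) n : ℂ) := by
  change (kroneckerSym (quadDisc d) (n : ZMod (quadDisc d)).val : ℂ) = _
  rw [ZMod.val_natCast, kroneckerSym_quadDisc_mod]

/-! ### Nontrivial zeros, ordinates, weights -/

/-- The nontrivial zeros (zeros in the open critical strip) of `F` at height `γ`, recorded by
their real parts. -/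
def zerosAt (F : ℂ → ℂ) (γ : ℝ) : Set ℝ := {β | 0 < β ∧ β < 1 ∧ F ⟨β, γ⟩ = 0}

/-- The set of positive ordinates of the nontrivial zeros of `F`. -/
def ordinates (F : ℂ → ℂ) : Set ℝ := {γ | 0 < γ ∧ (zerosAt F γ).Nonempty}

/-- The distinct positive ordinates of `F` in increasing order; the index starts at `0`, so
`ordinate F k` is the `(k + 1)`-st positive ordinate. -/
def ordinate (F : ℂ → ℂ) : ℕ → ℝ
  | 0 => sInf (ordinates F)
  | k + 1 => sInf {γ ∈ ordinates F | ordinate F k < γ}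

/-- The Lorentzian weight of a zero `β + iγ`. It equals `2 / (1/4 + γ²)` for `β = 1/2`. -/
def lorentzWeight (β γ : ℝ) : ℝ :=
  2 * (β * (1 - β) + γ ^ 2) /
    ((β * (1 - β) + γ ^ 2) ^ 2 + 4 * γ ^ 2 * (1 / 2 - β) ^ 2)

/-- The coefficient of the frequency `γ`: the sum of the weights of all nontrivial zeros of `F`
with ordinate `γ`, counted with multiplicity. -/
def ordinateWeight (F : ℂ → ℂ) (γ : ℝ) : ℝ :=
  ∑ᶠ β ∈ zerosAt F γ, (analyticOrderNatAt F ⟨β, γ⟩ : ℝ) * lorentzWeight β γ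

/-- The coefficient `b_k` of the `k`-th ordinate. -/
def coeff (F : ℂ → ℂ) (k : ℕ) : ℝ := ordinateWeight F (ordinate F k)

/-- The shifted zero sum `S_F(δ) = ∑ₖ bₖ cos(γₖ δ)`. -/
def shiftedSum (F : ℂ → ℂ) (δ : ℝ) : ℝ := ∑' k, coeff F k * Real.cos (ordinate F k * δ)

/-- The truncation of the shifted zero sum to the first `M` ordinates. -/
def truncSum (F : ℂ → ℂ) (M : ℕ) (δ : ℝ) : ℝ :=
  ∑ k ∈ Finset.range M, coeff F k * Real.cos (ordinate F k * δ)

/-- The infinite resonance lattice: the finitely supported integer sequences `n` with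
`∑ₖ nₖ γₖ = 0`. -/
def resonanceLattice (F : ℂ → ℂ) : Submodule ℤ (ℕ →₀ ℤ) :=
  LinearMap.ker (Finsupp.linearCombination ℤ (ordinate F))

/-! ### Cesàro distributions and their densities -/

/-- `μ` is the Cesàro distribution of `S`: a probability measure with
`lim_{T → ∞} (1 / 2T) ∫_{-T}^{T} g(S(δ)) dδ = ∫ g dμ` for all bounded continuous `g`.
(Such a `μ` is unique.) -/
def IsCesaroDistribution (S : ℝ → ℝ) (μ : Measure ℝ) : Prop :=
  IsProbabilityMeasure μ ∧ ∀ g : ℝ →ᵇ ℝ,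
    Tendsto (fun T : ℝ => (1 / (2 * T)) * ∫ δ in (-T)..T, g (S δ)) atTop (𝓝 (∫ x, g x ∂μ))

/-- `f` is the continuous density of `μ` with respect to Lebesgue measure. (A continuous density
is unique, so that its value at a point is determined by `μ`.) -/
def HasContinuousDensity (μ : Measure ℝ) (f : ℝ → ℝ) : Prop :=
  Continuous f ∧ (∀ x, 0 ≤ f x) ∧ μ = volume.withDensity fun x => ENNReal.ofReal (f x)

/-- The density at the origin of the Cesàro distribution of the full series is finite, and is the
limit of the truncated densities:
* the coefficients are summable, the Cesàro distributions `μ` of the full series and `ν M` of the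
  truncations exist;
* `μ`, and `ν M` for `M ≥ M₀`, have integrable characteristic functions and (finite-valued)
  continuous densities `f`, `g M`; `M₀ = 3` is possible if the resonance lattice is zero;
* the characteristic functions of `ν M` converge to that of `μ` in `L¹`,
  `f 0` is given by Fourier inversion, and `g M 0 → f 0`. -/
def FiniteLimitingDensity (F : ℂ → ℂ) : Prop :=
  Summable (coeff F) ∧
  ∃ (μ : Measure ℝ) (f : ℝ → ℝ) (ν : ℕ → Measure ℝ) (g : ℕ → ℝ → ℝ) (M₀ : ℕ),
    IsCesaroDistribution (shiftedSum F) μ ∧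
    (∀ M, IsCesaroDistribution (truncSum F M) (ν M)) ∧
    Integrable (charFun μ) ∧ HasContinuousDensity μ f ∧
    (∀ M ≥ M₀, Integrable (charFun (ν M)) ∧ HasContinuousDensity (ν M) (g M)) ∧
    (resonanceLattice F = ⊥ → M₀ ≤ 3) ∧
    Tendsto (fun M => ∫ t, ‖charFun (ν M) t - charFun μ t‖) atTop (𝓝 0) ∧
    (f 0 : ℂ) = (1 / (2 * Real.pi)) * ∫ t, charFun μ t ∧
    Tendsto (fun M => g M 0) atTop (𝓝 (f 0))

end

/-! ### Counting the zeros of entire functions of order less than two -/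

/-! The zeros are sparse enough for `∑ b_k` to converge, a finite-rank lattice couples only finitely
many frequencies, and the remaining frequencies behave like independent random phases, three of
which already smooth the distribution.

Sparsity: `s (1 - s) Λ(s, χ)` is entire and grows at most like `exp (C |s| ^ (3 / 2))`. Any exponent
in `(1, 2)` would do: above 1 it absorbs the gamma factor, below 2 Jensen's formula makes `∑ m(ρ) /
|ρ - 2| ^ 2` converge. Since the weight is at most `2 / γ ^ 2`, the `b_k` are summable
(`SparseZeros.summable_coeff`). The zeta function is the case of modulus 1.

Structure: finite rank gives a `K` such that every relation involves only `γ_k` with `k < K`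
(`exists_support_bound_of_rank_lt_aleph0`). The first `K` ordinates generate a free group of finite
rank, and a basis of it together with the later ordinates is independent
(`exists_independent_frequencies`). So `S_F` is a continuous function on a torus of countable
dimension, evaluated along an equidistributed linear flow (`tendsto_cesaroMean_torusFlow`), and its
Cesàro distribution is the image of Haar measure.

Smoothing: on the torus the terms with `k ≥ K` are independent of each other and of the head, so
`φ_M` is the characteristic function of the head times `∏ J₀(b_k t)` over `K ≤ k < M`. The head is
bounded by 1 and `J₀(x) = O(|x| ^ (-1 / 2))`, hence three tail factors give an integrable majorant
valid for all `M ≥ K + 3`. Dominated convergence and Fourier inversion conclude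
(`exists_limitingDensity`). -/

theorem sum_div_sq_le_of_counting {ι : Type*} {A : ℝ} (hA : 0 ≤ A) (Z : Finset ι) (m x : ι → ℝ)
    (hm : ∀ i ∈ Z, 0 ≤ m i) (hx : ∀ i ∈ Z, 1 ≤ x i)
    (hcount : ∀ R : ℝ, 1 ≤ R → ∑ i ∈ Z with x i ≤ R, m i ≤ A * R ^ (3 / 2 : ℝ)) :
    ∑ i ∈ Z, m i / x i ^ 2 ≤
      A * 2 ^ (3 / 2 : ℝ) * ∑' j : ℕ, ((2 : ℝ) ^ (3 / 2 : ℝ) / 4) ^ j := by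
  classical
  have hq : (2 : ℝ) ^ (3 / 2 : ℝ) < 4 := by
    have h4 : (4 : ℝ) = 2 ^ (2 : ℝ) := by norm_num
    rw [h4]
    exact Real.rpow_lt_rpow_of_exponent_lt one_lt_two (by norm_num)
  have hq0 : (0 : ℝ) < 2 ^ (3 / 2 : ℝ) := by positivity
  have hsum : Summable fun j : ℕ => ((2 : ℝ) ^ (3 / 2 : ℝ) / 4) ^ j :=
    summable_geometric_of_lt_one (by positivity) (by rw [div_lt_one (by norm_num)]; exact hq)
  -- Dyadic blocks `2 ^ j ≤ x < 2 ^ (j + 1)`: the mass of a block is at most `A * (2 ^ (j + 1)) ^ (3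
  -- / 2)` and its denominators are at least `4 ^ j`, so the block sums are dominated by a geometric
  -- series of ratio `2 ^ (3 / 2) / 4 < 1`.
  have hj : ∀ i, ∃ n : ℕ, i ∈ Z → (2 : ℝ) ^ n ≤ x i ∧ x i < 2 ^ (n + 1) := by
    intro i
    by_cases hi : i ∈ Z
    · obtain ⟨n, hn⟩ := exists_nat_pow_near (hx i hi) one_lt_two
      exact ⟨n, fun _ => hn⟩
    · exact ⟨0, fun h => absurd h hi⟩
  choose j hj using hj
  have h1 : ∑ i ∈ Z, m i / x i ^ 2 ≤ ∑ i ∈ Z, m i / 4 ^ j i := by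
    refine Finset.sum_le_sum fun i hi => ?_
    refine div_le_div_of_nonneg_left (hm i hi) (by positivity) ?_
    calc (4 : ℝ) ^ j i = (2 ^ j i) ^ 2 := by rw [← pow_mul, mul_comm, pow_mul]; norm_num
      _ ≤ x i ^ 2 := pow_le_pow_left₀ (by positivity) (hj i hi).1 2
  refine h1.trans ?_
  rw [← Finset.sum_fiberwise_of_maps_to (t := Z.image j)
    (fun i hi => Finset.mem_image_of_mem j hi)]
  have h2 : ∀ n : ℕ, ∑ i ∈ Z with j i = n, m i / 4 ^ j i ≤
      A * 2 ^ (3 / 2 : ℝ) * ((2 : ℝ) ^ (3 / 2 : ℝ) / 4) ^ n := by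
    intro n
    have e1 : ∑ i ∈ Z with j i = n, m i / (4 : ℝ) ^ j i = (∑ i ∈ Z with j i = n, m i) / 4 ^ n := by
      rw [Finset.sum_div]
      refine Finset.sum_congr rfl fun i hi => ?_
      rw [(Finset.mem_filter.1 hi).2]
    have e2 : ∑ i ∈ Z with j i = n, m i ≤ A * ((2 : ℝ) ^ (n + 1)) ^ (3 / 2 : ℝ) := by
      refine le_trans ?_ (hcount _ (one_le_pow₀ one_le_two))
      refine Finset.sum_le_sum_of_subset_of_nonneg ?_ ?_
      · intro i hi
        rw [Finset.mem_filter] at hi ⊢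
        refine ⟨hi.1, ?_⟩
        have := (hj i hi.1).2.le
        rwa [hi.2] at this
      · intro i hi _
        exact hm i (Finset.mem_filter.1 hi).1
    rw [e1, div_le_iff₀ (by positivity)]
    refine e2.trans (le_of_eq ?_)
    rw [div_pow, ← Real.rpow_natCast, ← Real.rpow_mul (by norm_num), mul_comm ((n + 1 : ℕ) : ℝ),
      Real.rpow_mul (by norm_num), Real.rpow_natCast, pow_succ]
    field_simp
  calc _ ≤ ∑ n ∈ Z.image j, A * 2 ^ (3 / 2 : ℝ) * ((2 : ℝ) ^ (3 / 2 : ℝ) / 4) ^ n :=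
        Finset.sum_le_sum fun n _ => h2 n
    _ = A * 2 ^ (3 / 2 : ℝ) * ∑ n ∈ Z.image j, ((2 : ℝ) ^ (3 / 2 : ℝ) / 4) ^ n := by
        rw [Finset.mul_sum]
    _ ≤ _ := by
        refine mul_le_mul_of_nonneg_left ?_ (by positivity)
        exact hsum.sum_le_tsum _ fun n _ => by positivity

theorem analyticOrderAt_ne_top_of_entire {G : ℂ → ℂ} (hG : Differentiable ℂ G) {c : ℂ}
    (hc : G c ≠ 0) (z : ℂ) : analyticOrderAt G z ≠ ⊤ := by
  intro h
  have han : AnalyticOnNhd ℂ G Set.univ := fun z _ => hG.analyticAt z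
  exact hc (han.eqOn_zero_of_preconnected_of_eventuallyEq_zero isPreconnected_univ
    (Set.mem_univ z) (analyticOrderAt_eq_top.1 h) (Set.mem_univ c))

/-- `G` grows at most like `exp (C (1 + ‖z‖) ^ (3 / 2))`. -/
def ModerateGrowth (G : ℂ → ℂ) : Prop :=
  ∃ C : ℝ, ∀ z, ‖G z‖ ≤ Real.exp (C * (1 + ‖z‖) ^ (3 / 2 : ℝ))

/-- Jensen's formula on the discs of radii `R` and `2 * R` about `c`: a zero in the smaller disc
contributes at least `log 2` per unit of multiplicity, while `log ‖G‖` is `O(R ^ (3 / 2))` on the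
larger circle. -/
theorem ModerateGrowth.sum_order_le {G : ℂ → ℂ} (hgr : ModerateGrowth G)
    (hG : Differentiable ℂ G) {c : ℂ} (hc : G c ≠ 0) :
    ∃ A : ℝ, 0 ≤ A ∧ ∀ R : ℝ, 1 ≤ R → ∀ Z : Finset ℂ, (∀ z ∈ Z, ‖z - c‖ ≤ R) →
      ∑ z ∈ Z, (analyticOrderNatAt G z : ℝ) ≤ A * R ^ (3 / 2 : ℝ) := by
  obtain ⟨C, hC⟩ := hgr
  have han : AnalyticOnNhd ℂ G Set.univ := fun z _ => hG.analyticAt z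
  set C' := max C 0 with hC'
  have hC0 : 0 ≤ C' := le_max_right _ _
  -- For `‖z - c‖ = 2 * R` and `R ≥ 1` one has `1 + ‖z‖ ≤ (3 + ‖c‖) * R`.
  set K : ℝ := C' * (3 + ‖c‖) ^ (3 / 2 : ℝ) with hK
  have hK0 : 0 ≤ K := by positivity
  have hlog2 : 0 < Real.log 2 := Real.log_pos one_lt_two
  refine ⟨(K + |Real.log ‖G c‖|) / Real.log 2, by positivity, fun R hR Z hZ => ?_⟩
  have hR0 : 0 < R := by linarith
  have hRp : 1 ≤ R ^ (3 / 2 : ℝ) := Real.one_le_rpow hR (by norm_num)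
  have hjen := AnalyticOnNhd.sum_divisor_le (f := G) (c := c) (r := R) (R := 2 * R)
    (M := Real.exp (K * R ^ (3 / 2 : ℝ))) (abs_pos.2 hR0.ne')
    (by rw [abs_of_pos hR0, abs_of_pos (by positivity)]; linarith)
    (Real.one_le_exp (by positivity)) (han.mono (Set.subset_univ _)) hc (by
      intro z hz
      refine (hC z).trans (Real.exp_le_exp.2 ?_)
      have hz' : ‖z‖ ≤ ‖c‖ + 2 * R := by
        have : ‖z - c‖ = 2 * R := by
          rw [mem_sphere_iff_norm] at hz; rw [hz, abs_of_pos (by positivity)]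
        calc ‖z‖ = ‖c + (z - c)‖ := by ring_nf
          _ ≤ ‖c‖ + ‖z - c‖ := norm_add_le _ _
          _ = _ := by rw [this]
      have h3 : 1 + ‖z‖ ≤ (3 + ‖c‖) * R := by nlinarith [norm_nonneg c]
      calc C * (1 + ‖z‖) ^ (3 / 2 : ℝ) ≤ C' * (1 + ‖z‖) ^ (3 / 2 : ℝ) :=
            mul_le_mul_of_nonneg_right (le_max_left _ _) (by positivity)
        _ ≤ C' * ((3 + ‖c‖) * R) ^ (3 / 2 : ℝ) := by gcongr
        _ = K * R ^ (3 / 2 : ℝ) := by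
            rw [Real.mul_rpow (by positivity) hR0.le, hK]; ring)
  have hbd : ∀ z ∈ Z, (MeromorphicOn.divisor G (Metric.closedBall c |R|) z : ℝ)
      = analyticOrderNatAt G z := by
    intro z hz
    rw [MeromorphicOn.AnalyticOnNhd.divisor_apply (han.mono (Set.subset_univ _)) (by
      rw [mem_closedBall_iff_norm, abs_of_pos hR0]; exact hZ z hz)]
    rw [← Nat.cast_analyticOrderNatAt (analyticOrderAt_ne_top_of_entire hG hc z)]
    simp
  have hsumle : ∑ z ∈ Z, (analyticOrderNatAt G z : ℝ) ≤
      ((∑ᶠ u, MeromorphicOn.divisor G (Metric.closedBall c |R|) u : ℤ) : ℝ) := by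
    rw [← Finset.sum_congr rfl hbd, ← Int.cast_sum, Int.cast_le]
    have hfs := (MeromorphicOn.divisor G (Metric.closedBall c |R|)).finiteSupport
      (isCompact_closedBall c |R|)
    classical
    rw [finsum_eq_sum_of_support_subset (s := hfs.toFinset ∪ Z) _ (by
      intro z hz; simpa using Or.inl hz)]
    refine Finset.sum_le_sum_of_subset_of_nonneg Finset.subset_union_right fun z _ _ => ?_
    exact MeromorphicOn.AnalyticOnNhd.divisor_nonneg (han.mono (Set.subset_univ _)) z
  refine hsumle.trans (hjen.trans ?_)
  rw [show 2 * R / R = 2 by field_simp, div_mul_eq_mul_div]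
  refine div_le_div_of_nonneg_right ?_ hlog2.le
  rw [Real.log_div (Real.exp_pos _).ne' (norm_ne_zero_iff.2 hc), Real.log_exp, add_mul]
  have := neg_abs_le (Real.log ‖G c‖)
  nlinarith [abs_nonneg (Real.log ‖G c‖)]

theorem ModerateGrowth.sum_order_div_sq_le {G : ℂ → ℂ} (hgr : ModerateGrowth G)
    (hG : Differentiable ℂ G) {c : ℂ} (hc : G c ≠ 0) :
    ∃ B : ℝ, ∀ Z : Finset ℂ,
      ∑ z ∈ Z, (analyticOrderNatAt G z : ℝ) / (1 + ‖z - c‖) ^ 2 ≤ B := by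
  obtain ⟨A, hA, h⟩ := hgr.sum_order_le hG hc
  refine ⟨_, fun Z => sum_div_sq_le_of_counting hA Z (fun z => analyticOrderNatAt G z)
    (fun z => 1 + ‖z - c‖) (fun z _ => Nat.cast_nonneg _) (fun z _ => by simp) fun R hR => ?_⟩
  refine h R hR _ fun z hz => ?_
  have := (Finset.mem_filter.1 hz).2
  linarith

theorem analyticOrderNatAt_pos_of_entire {G : ℂ → ℂ} (hG : Differentiable ℂ G) {c : ℂ}
    (hc : G c ≠ 0) {z : ℂ} (hz : G z = 0) : 0 < analyticOrderNatAt G z := by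
  rw [Nat.pos_iff_ne_zero]
  intro h
  have h1 := Nat.cast_analyticOrderNatAt (analyticOrderAt_ne_top_of_entire hG hc z)
  rw [h] at h1
  exact (hG.analyticAt z).analyticOrderAt_ne_zero.2 hz h1.symm

theorem ModerateGrowth.finite_zeros {G : ℂ → ℂ} (hgr : ModerateGrowth G)
    (hG : Differentiable ℂ G) {c : ℂ} (hc : G c ≠ 0) (R : ℝ) :
    {z | G z = 0 ∧ ‖z - c‖ ≤ R}.Finite := by
  obtain ⟨A, hA, h⟩ := hgr.sum_order_le hG hc
  by_contra hinf
  obtain ⟨Z, hZ, hcard⟩ := Set.Infinite.exists_subset_card_eq hinf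
    (⌊A * (max R 1) ^ (3 / 2 : ℝ)⌋₊ + 1)
  have h1 := h (max R 1) (le_max_right _ _) Z fun z hz => (hZ hz).2.trans (le_max_left _ _)
  have h2 : ((Z.card : ℕ) : ℝ) ≤ ∑ z ∈ Z, (analyticOrderNatAt G z : ℝ) := by
    rw [Finset.card_eq_sum_ones, Nat.cast_sum]
    refine Finset.sum_le_sum fun z hz => ?_
    exact_mod_cast analyticOrderNatAt_pos_of_entire hG hc (hZ hz).1
  rw [hcard] at h2
  have h3 := Nat.lt_floor_add_one (A * (max R 1) ^ (3 / 2 : ℝ))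
  push_cast at h2
  linarith

/-! ### Growth of completed `L`-functions -/

theorem one_le_one_add_norm_rpow (z : ℂ) : 1 ≤ (1 + ‖z‖) ^ (3 / 2 : ℝ) :=
  Real.one_le_rpow (by linarith [norm_nonneg z]) (by norm_num)

theorem one_add_norm_le_rpow (z : ℂ) : 1 + ‖z‖ ≤ (1 + ‖z‖) ^ (3 / 2 : ℝ) :=
  Real.self_le_rpow_of_one_le (by linarith [norm_nonneg z]) (by norm_num)

namespace ModerateGrowth

variable {F G : ℂ → ℂ}

theorem const (a : ℂ) : ModerateGrowth fun _ => a := by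
  refine ⟨‖a‖, fun z => ?_⟩
  have h1 : ‖a‖ ≤ ‖a‖ * (1 + ‖z‖) ^ (3 / 2 : ℝ) :=
    le_mul_of_one_le_right (norm_nonneg a) (one_le_one_add_norm_rpow z)
  have h2 := Real.add_one_le_exp (‖a‖ * (1 + ‖z‖) ^ (3 / 2 : ℝ))
  linarith

theorem id : ModerateGrowth fun z => z := by
  refine ⟨1, fun z => ?_⟩
  have h1 := one_add_norm_le_rpow z
  have h2 := Real.add_one_le_exp (1 * (1 + ‖z‖) ^ (3 / 2 : ℝ))
  linarith

theorem mul (hF : ModerateGrowth F) (hG : ModerateGrowth G) :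
    ModerateGrowth fun z => F z * G z := by
  obtain ⟨C, hC⟩ := hF
  obtain ⟨D, hD⟩ := hG
  refine ⟨C + D, fun z => ?_⟩
  rw [norm_mul, add_mul, Real.exp_add]
  exact mul_le_mul (hC z) (hD z) (norm_nonneg _) (Real.exp_pos _).le

theorem add (hF : ModerateGrowth F) (hG : ModerateGrowth G) :
    ModerateGrowth fun z => F z + G z := by
  obtain ⟨C, hC⟩ := hF
  obtain ⟨D, hD⟩ := hG
  refine ⟨1 + max C D, fun z => ?_⟩
  have hX := one_le_one_add_norm_rpow z
  set X := (1 + ‖z‖) ^ (3 / 2 : ℝ)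
  have h1 : ‖F z‖ ≤ Real.exp (max C D * X) := (hC z).trans
    (Real.exp_le_exp.2 (mul_le_mul_of_nonneg_right (le_max_left _ _) (by linarith)))
  have h2 : ‖G z‖ ≤ Real.exp (max C D * X) := (hD z).trans
    (Real.exp_le_exp.2 (mul_le_mul_of_nonneg_right (le_max_right _ _) (by linarith)))
  have h3 : 2 ≤ Real.exp X := by linarith [Real.add_one_le_exp X]
  rw [add_mul, one_mul, Real.exp_add]
  have := norm_add_le (F z) (G z)
  nlinarith [Real.exp_pos (max C D * X)]

theorem sub (hF : ModerateGrowth F) (hG : ModerateGrowth G) :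
    ModerateGrowth fun z => F z - G z := by
  simpa [sub_eq_add_neg] using hF.add ((const (-1)).mul hG)

theorem sum {ι : Type*} (s : Finset ι) {F : ι → ℂ → ℂ} (hF : ∀ i, ModerateGrowth (F i)) :
    ModerateGrowth fun z => ∑ i ∈ s, F i z := by
  classical
  induction s using Finset.induction_on with
  | empty => simpa using const 0
  | insert i s hi ih => simpa [Finset.sum_insert hi] using (hF i).add ih

theorem comp_affine (hF : ModerateGrowth F) (a b : ℂ) :
    ModerateGrowth fun z => F (a * z + b) := by
  obtain ⟨C, hC⟩ := hF
  refine ⟨max C 0 * (1 + ‖a‖ + ‖b‖) ^ (3 / 2 : ℝ), fun z => (hC _).trans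
    (Real.exp_le_exp.2 ?_)⟩
  have h1 : 1 + ‖a * z + b‖ ≤ (1 + ‖a‖ + ‖b‖) * (1 + ‖z‖) := by
    have h2 := norm_add_le (a * z) b
    rw [norm_mul] at h2
    nlinarith [norm_nonneg a, norm_nonneg b, norm_nonneg z, mul_nonneg (norm_nonneg b) (norm_nonneg z)]
  calc C * (1 + ‖a * z + b‖) ^ (3 / 2 : ℝ)
      ≤ max C 0 * (1 + ‖a * z + b‖) ^ (3 / 2 : ℝ) :=
        mul_le_mul_of_nonneg_right (le_max_left _ _) (by positivity)
    _ ≤ max C 0 * ((1 + ‖a‖ + ‖b‖) * (1 + ‖z‖)) ^ (3 / 2 : ℝ) := by gcongr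
    _ = _ := by rw [Real.mul_rpow (by positivity) (by positivity), mul_assoc]

theorem natCast_cpow_neg (N : ℕ) [NeZero N] : ModerateGrowth fun z => (N : ℂ) ^ (-z) := by
  refine ⟨Real.log N, fun z => ?_⟩
  have hN : (0 : ℝ) < N := by exact_mod_cast NeZero.pos N
  have hN1 : (1 : ℝ) ≤ N := by exact_mod_cast NeZero.one_le
  rw [Complex.norm_natCast_cpow_of_pos (NeZero.pos N), Real.rpow_def_of_pos hN]
  refine Real.exp_le_exp.2 (mul_le_mul_of_nonneg_left ?_ (Real.log_nonneg hN1))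
  have h1 := one_add_norm_le_rpow z
  have h2 := Complex.abs_re_le_norm z
  have h3 := neg_abs_le z.re
  rw [Complex.neg_re]
  linarith

end ModerateGrowth

/-- From `n! ≤ exp (n log n)` and `log n ≤ 2 * n ^ (1 / 2)`. This factorial is the growth of the
gamma factor, and the reason for a growth exponent above 1. -/
theorem factorial_div_pow_le {c : ℝ} (hc : 0 < c) (n : ℕ) {z : ℂ} (hn : (n : ℝ) ≤ 2 * (1 + ‖z‖)) :
    (n.factorial : ℝ) / c ^ n ≤
      Real.exp ((2 * 2 ^ (3 / 2 : ℝ) + 2 * |Real.log c|) * (1 + ‖z‖) ^ (3 / 2 : ℝ)) := by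
  rcases Nat.eq_zero_or_pos n with rfl | hn0
  · simp only [Nat.factorial_zero, Nat.cast_one, pow_zero, div_one]
    exact Real.one_le_exp (by positivity)
  have hn0' : (0 : ℝ) < n := by exact_mod_cast hn0
  have h1 : (n.factorial : ℝ) ≤ Real.exp (2 * (n : ℝ) ^ (3 / 2 : ℝ)) := by
    calc (n.factorial : ℝ) ≤ (n : ℝ) ^ n := by exact_mod_cast Nat.factorial_le_pow n
      _ = Real.exp (n * Real.log n) := by
          rw [mul_comm, Real.exp_mul, Real.exp_log hn0', Real.rpow_natCast]
      _ ≤ _ := by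
          refine Real.exp_le_exp.2 ?_
          have := Real.log_le_rpow_div hn0'.le (ε := 1 / 2) (by norm_num)
          calc n * Real.log n ≤ n * ((n : ℝ) ^ (1 / 2 : ℝ) / (1 / 2)) := by gcongr
            _ = 2 * ((n : ℝ) ^ (1 : ℝ) * (n : ℝ) ^ (1 / 2 : ℝ)) := by rw [Real.rpow_one]; ring
            _ = _ := by rw [← Real.rpow_add hn0']; norm_num
  have h2 : (c ^ n)⁻¹ ≤ Real.exp (n * |Real.log c|) := by
    rw [← Real.exp_log (pow_pos hc n), ← Real.exp_neg, Real.log_pow]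
    refine Real.exp_le_exp.2 ?_
    rw [← mul_neg]
    exact mul_le_mul_of_nonneg_left (neg_le_abs _) hn0'.le
  rw [div_eq_mul_inv]
  refine (mul_le_mul h1 h2 (by positivity) (Real.exp_pos _).le).trans ?_
  rw [← Real.exp_add]
  refine Real.exp_le_exp.2 ?_
  have h3 : (n : ℝ) ^ (3 / 2 : ℝ) ≤ 2 ^ (3 / 2 : ℝ) * (1 + ‖z‖) ^ (3 / 2 : ℝ) := by
    rw [← Real.mul_rpow (by positivity) (by positivity)]
    gcongr
  have h4 : (n : ℝ) ≤ 2 * (1 + ‖z‖) ^ (3 / 2 : ℝ) := by linarith [one_add_norm_le_rpow z]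
  have h5 := mul_le_mul_of_nonneg_right h4 (abs_nonneg (Real.log c))
  linarith

/-- Both `x` and `x⁻¹` are at most `y = x + x⁻¹`, and `(c * y) ^ n / n!` is one term of the series
of `exp (c * y)`. The exponent `a` survives only through `n`, and the weight is symmetric under `x ↦
x⁻¹`. -/
theorem rpow_le_factorial_mul_exp {c x a : ℝ} (hc : 0 < c) (hx : 0 < x) (n : ℕ) (hn : |a| ≤ n) :
    x ^ a ≤ n.factorial / c ^ n * Real.exp (c * (x + x⁻¹)) := by
  have hx' : 0 < x⁻¹ := inv_pos.2 hx
  have hy : 1 ≤ x + x⁻¹ := by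
    rcases le_total 1 x with h | h
    · linarith
    · have := (one_le_inv₀ hx).2 h
      linarith
  have h1 : x ^ a ≤ (x + x⁻¹) ^ |a| := by
    rcases le_total 0 a with h | h
    · rw [abs_of_nonneg h]
      exact Real.rpow_le_rpow hx.le (by linarith) h
    · rw [abs_of_nonpos h]
      calc x ^ a = x⁻¹ ^ (-a) := by rw [Real.inv_rpow hx.le, Real.rpow_neg hx.le, inv_inv]
        _ ≤ _ := Real.rpow_le_rpow hx'.le (by linarith) (by linarith)
  have h2 : (x + x⁻¹) ^ |a| ≤ (x + x⁻¹) ^ n := by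
    rw [← Real.rpow_natCast]
    exact Real.rpow_le_rpow_of_exponent_le hy hn
  have h3 := Real.pow_div_factorial_le_exp (c * (x + x⁻¹)) (by positivity) n
  rw [div_le_iff₀ (by positivity), mul_pow] at h3
  refine h1.trans (h2.trans ?_)
  rw [div_mul_eq_mul_div, le_div_iff₀ (by positivity)]
  linarith

theorem integrableOn_mul_exp_of_isBigO {f : ℝ → ℂ} (hf : LocallyIntegrableOn f (Set.Ioi 0))
    {p c : ℝ} (hc : 0 < c) (hcp : c < p)
    (htop : f =O[atTop] fun x => Real.exp (-p * x))
    (hzero : (fun x => f x⁻¹) =O[atTop] fun x => Real.exp (-p * x)) :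
    IntegrableOn (fun x => f x * Real.exp (c * (x + x⁻¹))) (Set.Ioi 0) := by
  set h : ℝ → ℂ := fun x => f x * Real.exp (c * (x + x⁻¹)) with hh
  have hcont : ContinuousOn (fun x : ℝ => ((Real.exp (c * (x + x⁻¹)) : ℝ) : ℂ)) (Set.Ioi 0) := by
    refine Complex.continuous_ofReal.comp_continuousOn (Real.continuous_exp.comp_continuousOn ?_)
    refine continuousOn_const.mul (continuousOn_id.add (continuousOn_inv₀.mono ?_))
    intro x hx
    exact ne_of_gt hx
  have hloc : LocallyIntegrableOn h (Set.Ioi 0) :=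
    hf.mul_continuousOn hcont isOpen_Ioi.isLocallyClosed
  have key : ∀ g : ℝ → ℂ, g =O[atTop] (fun x => Real.exp (-p * x)) →
      (fun x => g x * Real.exp (c * (x + x⁻¹))) =O[atTop] fun x : ℝ => x ^ (-2 : ℝ) := by
    intro g hg
    have hW : (fun x : ℝ => ((Real.exp (c * (x + x⁻¹)) : ℝ) : ℂ)) =O[atTop]
        fun x => Real.exp (c * x) := by
      refine Asymptotics.IsBigO.of_bound (Real.exp c) ?_
      filter_upwards [eventually_ge_atTop 1] with x hx
      rw [Complex.norm_real, Real.norm_of_nonneg (Real.exp_pos _).le,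
        Real.norm_of_nonneg (Real.exp_pos _).le, ← Real.exp_add]
      refine Real.exp_le_exp.2 ?_
      have : x⁻¹ ≤ 1 := inv_le_one_of_one_le₀ hx
      nlinarith
    refine (hg.mul hW).trans (((isLittleO_exp_neg_mul_rpow_atTop (sub_pos.2 hcp) (-2)).isBigO).congr_left
      fun x => ?_)
    rw [← Real.exp_add]
    ring_nf
  have h1 : h =O[atTop] fun x : ℝ => x ^ (-2 : ℝ) := key f htop
  have h2 : h =O[𝓝[>] 0] fun x : ℝ => x ^ (-(-2) : ℝ) := by
    have h3 := (key _ hzero).comp_tendsto tendsto_inv_nhdsGT_zero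
    refine Asymptotics.IsBigO.congr' h3 ?_ ?_
    · filter_upwards with x
      simp [hh, add_comm]
    · filter_upwards [self_mem_nhdsWithin] with x hx
      have hx : 0 < x := hx
      simp only [Function.comp_apply]
      rw [Real.inv_rpow hx.le, Real.rpow_neg hx.le, inv_inv, neg_neg]
  -- Mellin convergence at `s = 1` is plain integrability on `(0, ∞)`; the exponents `-2` at
  -- infinity and `2` at zero are one convenient choice.
  have h4 := mellinConvergent_of_isBigO_rpow (s := 1) hloc h1 (by norm_num) h2 (by norm_num)
  simpa [MellinConvergent] using h4

/-- The Mellin transform of a function decaying exponentially at `∞` and at `0`. -/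
theorem moderateGrowth_mellin {f : ℝ → ℂ} (hf : LocallyIntegrableOn f (Set.Ioi 0))
    {p : ℝ} (hp : 0 < p) (htop : f =O[atTop] fun x => Real.exp (-p * x))
    (hzero : (fun x => f x⁻¹) =O[atTop] fun x => Real.exp (-p * x)) :
    ModerateGrowth (mellin f) := by
  -- Half of the decay rate is spent on the weight `exp (c * (x + x⁻¹))`, against which `f` stays
  -- integrable. That weight dominates `x ^ (s - 1)` at the price of `n! / c ^ n`, where `n` is
  -- about `|re s - 1|`.
  have hc : 0 < p / 2 := by positivity
  set c := p / 2
  have hint := integrableOn_mul_exp_of_isBigO hf hc (by simp only [c]; linarith) htop hzero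
  set I := ∫ x in Set.Ioi (0 : ℝ), ‖f x * Real.exp (c * (x + x⁻¹))‖ with hI
  have hI0 : 0 ≤ I := integral_nonneg fun x => norm_nonneg _
  refine ⟨(2 * 2 ^ (3 / 2 : ℝ) + 2 * |Real.log c|) + I, fun s => ?_⟩
  set n := ⌈|s.re - 1|⌉₊ with hn
  have hn2 : (n : ℝ) ≤ 2 * (1 + ‖s‖) := by
    have h1 := (Nat.ceil_lt_add_one (abs_nonneg (s.re - 1))).le
    have h2 := abs_sub s.re 1
    have h3 := Complex.abs_re_le_norm s
    rw [abs_one] at h2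
    rw [← hn] at h1
    linarith [norm_nonneg s]
  have hb : ‖mellin f s‖ ≤ (n.factorial : ℝ) / c ^ n * I := by
    rw [hI, ← integral_const_mul]
    refine norm_integral_le_of_norm_le (hint.norm.const_mul _) ?_
    filter_upwards [ae_restrict_mem measurableSet_Ioi] with x hx
    have hx : 0 < x := hx
    rw [smul_eq_mul, norm_mul, norm_mul, Complex.norm_cpow_eq_rpow_re_of_pos hx,
      Complex.norm_real, Real.norm_of_nonneg (Real.exp_pos _).le]
    have := rpow_le_factorial_mul_exp (a := s.re - 1) hc hx n (Nat.le_ceil _)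
    rw [Complex.sub_re, Complex.one_re]
    nlinarith [norm_nonneg (f x)]
  refine hb.trans ?_
  rw [add_mul, Real.exp_add]
  refine mul_le_mul (factorial_div_pow_le hc n hn2) ?_ hI0 (Real.exp_pos _).le
  have h1 : I ≤ I * (1 + ‖s‖) ^ (3 / 2 : ℝ) :=
    le_mul_of_one_le_right hI0 (one_le_one_add_norm_rpow s)
  linarith [Real.add_one_le_exp (I * (1 + ‖s‖) ^ (3 / 2 : ℝ))]

theorem WeakFEPair.f_modif_isBigO (P : WeakFEPair ℂ) {p : ℝ}
    (hf : (fun x => P.f x - P.f₀) =O[atTop] fun x => Real.exp (-p * x)) :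
    P.f_modif =O[atTop] fun x => Real.exp (-p * x) := by
  refine hf.congr' ?_ EventuallyEq.rfl
  filter_upwards [eventually_gt_atTop 1] with x hx
  simp [WeakFEPair.f_modif, Set.indicator, hx, not_lt.2 hx.le]

/-- `Λ₀` is the Mellin transform of `f_modif`, whose decay at zero is the decay of `g - g₀` at
infinity carried over by the functional equation. -/
theorem WeakFEPair.moderateGrowth_Λ₀ (P : WeakFEPair ℂ) {p q : ℝ} (hp : 0 < p) (hq : 0 < q)
    (hf : (fun x => P.f x - P.f₀) =O[atTop] fun x => Real.exp (-p * x))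
    (hg : (fun x => P.g x - P.g₀) =O[atTop] fun x => Real.exp (-q * x)) :
    ModerateGrowth P.Λ₀ := by
  have hmono : ∀ {a b : ℝ}, a ≤ b → (fun x : ℝ => Real.exp (-b * x)) =O[atTop]
      fun x => Real.exp (-a * x) := by
    intro a b hab
    refine Asymptotics.IsBigO.of_bound 1 ?_
    filter_upwards [eventually_ge_atTop 0] with x hx
    rw [Real.norm_of_nonneg (Real.exp_pos _).le, Real.norm_of_nonneg (Real.exp_pos _).le, one_mul]
    exact Real.exp_le_exp.2 (by nlinarith)
  -- The functional equation brings in a factor `x ^ k`; it is absorbed by half of the rate `q`.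
  refine moderateGrowth_mellin (p := min p (q / 2)) P.hf_modif_int (by positivity)
    ((P.f_modif_isBigO hf).trans (hmono (min_le_left _ _))) ?_
  have hpow : (fun x : ℝ => P.ε * ((x ^ P.k : ℝ) : ℂ)) =O[atTop]
      fun x => Real.exp (q / 2 * x) := by
    refine Asymptotics.IsBigO.const_mul_left ?_ _
    rw [← Asymptotics.isBigO_norm_left]
    simp_rw [Complex.norm_real]
    rw [Asymptotics.isBigO_norm_left]
    exact (isLittleO_rpow_exp_pos_mul_atTop _ (by positivity)).isBigO
  have h1 := hpow.mul (P.symm.f_modif_isBigO (p := q) hg)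
  refine Asymptotics.IsBigO.trans ?_ (hmono (min_le_right p (q / 2)))
  refine Asymptotics.IsBigO.congr' h1 ?_ ?_
  · filter_upwards [eventually_gt_atTop 0] with x hx
    rw [← one_div, P.hf_modif_FE x hx]
    rfl
  · filter_upwards with x
    rw [← Real.exp_add]
    ring_nf

theorem moderateGrowth_completedHurwitzZetaEven₀ (a : UnitAddCircle) :
    ModerateGrowth (HurwitzZeta.completedHurwitzZetaEven₀ a) := by
  obtain ⟨p, hp, hp'⟩ := HurwitzZeta.isBigO_atTop_evenKernel_sub a
  obtain ⟨q, hq, hq'⟩ := HurwitzZeta.isBigO_atTop_cosKernel_sub a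
  have h := (HurwitzZeta.hurwitzEvenFEPair a).moderateGrowth_Λ₀ hp hq
    (by
      rw [← Asymptotics.isBigO_norm_left] at hp' ⊢
      refine hp'.congr_left fun x => ?_
      rw [← Complex.norm_real]
      simp only [HurwitzZeta.hurwitzEvenFEPair, Function.comp_apply]
      push_cast
      split_ifs <;> simp)
    (by
      rw [← Asymptotics.isBigO_norm_left] at hq' ⊢
      refine hq'.congr_left fun x => ?_
      rw [← Complex.norm_real]
      simp [HurwitzZeta.hurwitzEvenFEPair])
  have h2 := (h.comp_affine (1 / 2) 0).mul (ModerateGrowth.const (1 / 2))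
  convert h2 using 2 with s
  rw [HurwitzZeta.completedHurwitzZetaEven₀]
  ring_nf

theorem moderateGrowth_completedHurwitzZetaOdd (a : UnitAddCircle) :
    ModerateGrowth (HurwitzZeta.completedHurwitzZetaOdd a) := by
  obtain ⟨p, hp, hp'⟩ := HurwitzZeta.isBigO_atTop_oddKernel a
  obtain ⟨q, hq, hq'⟩ := HurwitzZeta.isBigO_atTop_sinKernel a
  have h := (HurwitzZeta.hurwitzOddFEPair a).moderateGrowth_Λ₀ hp hq
    (by
      rw [← Asymptotics.isBigO_norm_left] at hp' ⊢
      refine hp'.congr_left fun x => ?_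
      rw [← Complex.norm_real]
      simp [HurwitzZeta.hurwitzOddFEPair])
    (by
      rw [← Asymptotics.isBigO_norm_left] at hq' ⊢
      refine hq'.congr_left fun x => ?_
      rw [← Complex.norm_real]
      simp [HurwitzZeta.hurwitzOddFEPair])
  have h2 := (h.comp_affine (1 / 2) (1 / 2)).mul (ModerateGrowth.const (1 / 2))
  convert h2 using 2 with s
  rw [HurwitzZeta.completedHurwitzZetaOdd, WeakFEPair.Λ]
  simp only [HurwitzZeta.hurwitzOddFEPair, smul_zero, sub_zero]
  ring_nf

theorem moderateGrowth_completedLFunction₀ {N : ℕ} [NeZero N] (Φ : ZMod N → ℂ) :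
    ModerateGrowth (ZMod.completedLFunction₀ Φ) := by
  have hN := ModerateGrowth.natCast_cpow_neg N
  exact (hN.mul (ModerateGrowth.sum _ fun j => (ModerateGrowth.const _).mul
    (moderateGrowth_completedHurwitzZetaEven₀ _))).add
    (hN.mul (ModerateGrowth.sum _ fun j => (ModerateGrowth.const _).mul
    (moderateGrowth_completedHurwitzZetaOdd _)))

/-! ### The entire completion of a Dirichlet `L`-function -/

namespace DirichletCharacter

theorem gammaFactor_ne_zero {N : ℕ} (χ : DirichletCharacter ℂ N) {s : ℂ} (hs : 0 < s.re) : gammaFactor χ s ≠ 0 := by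
  unfold gammaFactor
  split_ifs
  · exact Complex.Gammaℝ_ne_zero_of_re_pos hs
  · exact Complex.Gammaℝ_ne_zero_of_re_pos (by rw [Complex.add_re, Complex.one_re]; linarith)

theorem differentiable_inv_gammaFactor {N : ℕ} (χ : DirichletCharacter ℂ N) :
    Differentiable ℂ fun s => (gammaFactor χ s)⁻¹ := by
  unfold gammaFactor
  split_ifs
  · exact Complex.differentiable_Gammaℝ_inv
  · exact Complex.differentiable_Gammaℝ_inv.comp (differentiable_id.add_const 1)

variable {N : ℕ} [NeZero N] (χ : DirichletCharacter ℂ N)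

/-- The entire function `s (1 - s) Λ(s, χ)`. -/
noncomputable def entireLFunction (s : ℂ) : ℂ :=
  s * (1 - s) * ZMod.completedLFunction₀ χ s -
    ((N : ℂ) ^ (-s) * χ 0 * (1 - s) + (N : ℂ) ^ (-s) * (∑ j, χ j) * s)

/-- The cofactor is holomorphic and nonzero where `re s > 0` and `s ≠ 1`, because the gamma factor
has no zero there and its reciprocal is entire. Hence the zeros in the strip, with their orders, are
those of an entire function. -/
theorem LFunction_eq_entireLFunction {s : ℂ} (h0 : 0 < s.re) (h1 : s ≠ 1) :
    LFunction χ s = entireLFunction χ s * ((s * (1 - s))⁻¹ * (gammaFactor χ s)⁻¹) := by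
  have h1' : 1 - s ≠ 0 := sub_ne_zero.2 h1.symm
  have h0' : s ≠ 0 := fun h => by simp [h] at h0
  have hg := gammaFactor_ne_zero χ h0
  rw [LFunction_eq_completed_div_gammaFactor χ s (Or.inl h0'),
    show completedLFunction χ s = ZMod.completedLFunction χ s from rfl,
    ZMod.completedLFunction_eq, entireLFunction]
  field_simp
  ring

theorem LFunction_eq_zero_iff {s : ℂ} (h0 : 0 < s.re) (h1 : s ≠ 1) :
    LFunction χ s = 0 ↔ entireLFunction χ s = 0 := by
  have h1' : 1 - s ≠ 0 := sub_ne_zero.2 h1.symm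
  have h0' : s ≠ 0 := fun h => by simp [h] at h0
  simp [LFunction_eq_entireLFunction χ h0 h1, gammaFactor_ne_zero χ h0, h0', h1']

theorem differentiable_entireLFunction : Differentiable ℂ (entireLFunction χ) := by
  have h0 := ZMod.differentiable_completedLFunction₀ (N := N) χ
  have h1 : Differentiable ℂ fun s : ℂ => (N : ℂ) ^ (-s) := by
    intro s
    exact DifferentiableAt.const_cpow (by fun_prop) (Or.inl (by exact_mod_cast NeZero.ne N))
  unfold entireLFunction
  fun_prop

theorem moderateGrowth_entireLFunction : ModerateGrowth (entireLFunction χ) := by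
  have hN := ModerateGrowth.natCast_cpow_neg N
  have hs := (ModerateGrowth.const 1).sub ModerateGrowth.id
  exact ((ModerateGrowth.id.mul hs).mul (moderateGrowth_completedLFunction₀ _)).sub
    (((hN.mul (.const _)).mul hs).add ((hN.mul (.const _)).mul .id))

/-- The point `2` lies to the right of the critical strip, where the `L`-function does not vanish;
it serves as the centre for Jensen's formula. -/
theorem entireLFunction_two_ne_zero : entireLFunction χ 2 ≠ 0 := by
  rw [Ne, ← LFunction_eq_zero_iff χ (by norm_num) (by norm_num)]
  exact LFunction_ne_zero_of_one_le_re χ (Or.inr (by norm_num)) (by norm_num)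

theorem analyticOrderNatAt_LFunction {s : ℂ} (h0 : 0 < s.re) (h1 : s ≠ 1) :
    analyticOrderNatAt (LFunction χ) s = analyticOrderNatAt (entireLFunction χ) s := by
  have h1' : 1 - s ≠ 0 := sub_ne_zero.2 h1.symm
  have h0' : s ≠ 0 := fun h => by simp [h] at h0
  set h : ℂ → ℂ := fun s => (s * (1 - s))⁻¹ * (gammaFactor χ s)⁻¹ with hh
  have hopen : IsOpen {s : ℂ | 0 < s.re ∧ s ≠ 1} :=
    (isOpen_lt continuous_const Complex.continuous_re).inter isOpen_ne
  have hmem : {s : ℂ | 0 < s.re ∧ s ≠ 1} ∈ 𝓝 s := hopen.mem_nhds ⟨h0, h1⟩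
  have hev : LFunction χ =ᶠ[𝓝 s] entireLFunction χ * h := by
    filter_upwards [hmem] with z hz
    exact LFunction_eq_entireLFunction χ hz.1 hz.2
  have hhan : AnalyticAt ℂ h s := by
    refine AnalyticAt.mul (AnalyticAt.inv (by fun_prop) (mul_ne_zero h0' h1')) ?_
    exact (differentiable_inv_gammaFactor χ).analyticAt s
  have hhne : h s ≠ 0 :=
    mul_ne_zero (inv_ne_zero (mul_ne_zero h0' h1')) (inv_ne_zero (gammaFactor_ne_zero χ h0))
  unfold analyticOrderNatAt
  rw [analyticOrderAt_congr hev,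
    analyticOrderAt_mul ((differentiable_entireLFunction χ).analyticAt s) hhan,
    hhan.analyticOrderAt_eq_zero.2 hhne, add_zero]

end DirichletCharacter

/-! ### Lattices of finite rank -/

/-- A maximal independent set in `Λ` is finite, so its span has supports in a common initial
segment. Over `ℤ` it need not span `Λ`, but every element of `Λ` has a nonzero multiple in its span,
and such a multiple has the same support. -/
theorem exists_support_bound_of_rank_lt_aleph0 (Λ : Submodule ℤ (ℕ →₀ ℤ))
    (h : Module.rank ℤ Λ < Cardinal.aleph0) : ∃ K : ℕ, ∀ n ∈ Λ, ∀ k ≥ K, n k = 0 := by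
  obtain ⟨s, hcard, hs⟩ := exists_set_linearIndependent_of_isDomain ℤ Λ
  have hsfin : s.Finite := by
    rw [← Cardinal.lt_aleph0_iff_set_finite, hcard]
    exact h
  obtain ⟨K, hK⟩ : ∃ K : ℕ, ∀ v ∈ s, ∀ k ≥ K, (v : ℕ →₀ ℤ) k = 0 := by
    obtain ⟨K, hK⟩ := (hsfin.toFinset.biUnion fun v => (v : ℕ →₀ ℤ).support).bddAbove
    refine ⟨K + 1, fun v hv k hk => ?_⟩
    by_contra hne
    have : k ≤ K := hK (by
      simp only [Finset.coe_biUnion, Set.mem_iUnion]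
      exact ⟨v, by simpa using hv, by simpa using hne⟩)
    omega
  have hspan : ∀ v ∈ Submodule.span ℤ s, ∀ k ≥ K, (v : ℕ →₀ ℤ) k = 0 := by
    intro v hv k hk
    induction hv using Submodule.span_induction with
    | mem v hv => exact hK v hv k hk
    | zero => simp
    | add v w _ _ hv hw => simp [hv, hw]
    | smul a v _ hv => simp [hv]
  refine ⟨K, fun n hn k hk => ?_⟩
  by_contra hne
  -- Elements of the span vanish at `k`, while `n k ≠ 0`. So `n` could be adjoined to `s`, exceeding
  -- the rank.
  have hind : ∀ r : ℤ, r • (⟨n, hn⟩ : Λ) ∈ Submodule.span ℤ s → r = 0 := by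
    intro r hr
    have := hspan _ hr k hk
    simpa [hne] using this
  have hnotin : (⟨n, hn⟩ : Λ) ∉ s := fun hmem => hne (hK _ hmem k hk)
  have hins : LinearIndepOn ℤ _root_.id (insert (⟨n, hn⟩ : Λ) s) := by
    refine LinearIndepOn.id_insert' hs ?_
    intro r hr
    exact hind r hr
  have hle := hins.cardinal_le_rank
  rw [Cardinal.mk_insert hnotin, hcard] at hle
  exact absurd hle (not_le.2 (by
    obtain ⟨m, hm⟩ := Cardinal.lt_aleph0.1 h
    rw [hm]
    exact_mod_cast Nat.lt_succ_self m))

/-! ### Ordinates of zeros -/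

section ordinates

variable {F : ℂ → ℂ}

theorem csInf_mem_of_finite_inter {S : Set ℝ} (hS : S.Nonempty)
    (hfin : ∀ T, (S ∩ Set.Iic T).Finite) : IsLeast S (sInf S) := by
  obtain ⟨a, ha⟩ := hS
  obtain ⟨m, hm, hmin⟩ := (hfin a).exists_minimalFor (fun x => x) _ ⟨a, ha, le_refl a⟩
  have hle : IsLeast S m := by
    refine ⟨hm.1, fun x hx => ?_⟩
    rcases le_total x m with h | h
    · exact hmin ⟨hx, h.trans hm.2⟩ h
    · exact h
  rwa [hle.csInf_eq]

/-- Discreteness turns each infimum in the definition of `ordinate` into a minimum, and infinitude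
keeps the sets nonempty. -/
theorem ordinate_mem_and_lt (hfin : ∀ T, (ordinates F ∩ Set.Iic T).Finite)
    (hinf : (ordinates F).Infinite) (k : ℕ) :
    ordinate F k ∈ ordinates F ∧ ordinate F k < ordinate F (k + 1) := by
  have hnext : ∀ a : ℝ, IsLeast {γ ∈ ordinates F | a < γ} (sInf {γ ∈ ordinates F | a < γ}) := by
    intro a
    refine csInf_mem_of_finite_inter ?_ fun T => (hfin T).subset fun x hx => ⟨hx.1.1, hx.2⟩
    by_contra hne
    refine hinf ((hfin a).subset fun x hx => ⟨hx, ?_⟩)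
    by_contra hax
    exact hne ⟨x, hx, not_le.1 hax⟩
  refine ⟨?_, (hnext (ordinate F k)).1.2⟩
  cases k with
  | zero => exact (csInf_mem_of_finite_inter hinf.nonempty hfin).1
  | succ k => exact (hnext (ordinate F k)).1.1

theorem finite_range_ordinate (hord : (ordinates F).Finite) : (Set.range (ordinate F)).Finite := by
  -- Once the ordinates are exhausted the recursion takes `sInf ∅ = 0`, hence the additional value
  -- `0`.
  have hmem : ∀ S ⊆ ordinates F, sInf S ∈ insert 0 (ordinates F) := by
    intro S hS
    rcases S.eq_empty_or_nonempty with rfl | hne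
    · simp
    · exact Or.inr (hS (csInf_mem_of_finite_inter hne
        fun T => hord.subset (Set.inter_subset_left.trans hS)).1)
  refine (hord.insert 0).subset ?_
  rintro _ ⟨k, rfl⟩
  cases k with
  | zero => exact hmem _ le_rfl
  | succ k => exact hmem _ fun x hx => hx.1

/-- If the ordinates were finite in number, the sequence `ordinate F` would repeat its values
(`sInf ∅ = 0`), and its relations would have unbounded support. So the main case,
an infinite strictly increasing sequence of ordinates, is the only one. -/
theorem infinite_ordinates_of_support_bound {K : ℕ}
    (hK : ∀ n ∈ resonanceLattice F, ∀ k ≥ K, n k = 0) : (ordinates F).Infinite := by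
  intro hord
  have hrange := finite_range_ordinate hord
  obtain ⟨i, j, hij, heq⟩ : ∃ i j : ℕ, i ≠ j ∧ ordinate F (K + i) = ordinate F (K + j) := by
    have hni : ¬ Function.Injective fun i => ordinate F (K + i) := by
      intro hinj
      exact Set.infinite_range_of_injective hinj (hrange.subset (by
        rintro _ ⟨i, rfl⟩
        exact ⟨_, rfl⟩))
    simp only [Function.Injective] at hni
    push Not at hni
    obtain ⟨i, j, h1, h2⟩ := hni
    exact ⟨i, j, h2, h1⟩
  have hmem : Finsupp.single (K + i) 1 - Finsupp.single (K + j) 1 ∈ resonanceLattice F := by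
    rw [resonanceLattice, LinearMap.mem_ker, map_sub]
    simp [heq]
  have := hK _ hmem (K + i) (by omega)
  simp [hij.symm] at this

theorem lorentzWeight_pos {β γ : ℝ} (h0 : 0 < β) (h1 : β < 1) : 0 < lorentzWeight β γ := by
  have : 0 < β * (1 - β) := mul_pos h0 (by linarith)
  unfold lorentzWeight
  positivity

theorem lorentzWeight_le {β γ : ℝ} (h0 : 0 < β) (h1 : β < 1) (hγ : 0 < γ) :
    lorentzWeight β γ ≤ 2 / γ ^ 2 := by
  have h : 0 < β * (1 - β) := mul_pos h0 (by linarith)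
  unfold lorentzWeight
  rw [div_le_div_iff₀ (by positivity) (by positivity)]
  have h2 : 0 ≤ 4 * γ ^ 2 * (1 / 2 - β) ^ 2 := by positivity
  nlinarith [mul_pos h (pow_pos hγ 2), mul_pos h h]

/-- The facts on the zeros of `F` in the critical strip that are used: they are discrete, have
positive order, and are sparse. -/
structure SparseZeros (F : ℂ → ℂ) : Prop where
  finite_strip : ∀ T : ℝ, {ρ : ℂ | 0 < ρ.re ∧ ρ.re < 1 ∧ 0 < ρ.im ∧ ρ.im ≤ T ∧ F ρ = 0}.Finite
  order_pos : ∀ ρ : ℂ, 0 < ρ.re → ρ.re < 1 → F ρ = 0 → 0 < analyticOrderNatAt F ρ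
  sum_le : ∃ B : ℝ, ∀ Z : Finset ℂ, (∀ ρ ∈ Z, 0 < ρ.re ∧ ρ.re < 1 ∧ 0 < ρ.im) →
    ∑ ρ ∈ Z, (analyticOrderNatAt F ρ : ℝ) / (3 + ρ.im) ^ 2 ≤ B

namespace SparseZeros

theorem finite_ordinates (h : SparseZeros F) (T : ℝ) : (ordinates F ∩ Set.Iic T).Finite := by
  refine ((h.finite_strip T).image Complex.im).subset ?_
  rintro γ ⟨⟨hγ, β, hβ0, hβ1, hF⟩, hT⟩
  exact ⟨⟨β, γ⟩, ⟨hβ0, hβ1, hγ, hT, hF⟩, rfl⟩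

theorem finite_zerosAt (h : SparseZeros F) {γ : ℝ} (hγ : 0 < γ) : (zerosAt F γ).Finite := by
  refine ((h.finite_strip γ).image Complex.re).subset ?_
  rintro β ⟨hβ0, hβ1, hF⟩
  exact ⟨⟨β, γ⟩, ⟨hβ0, hβ1, hγ, le_refl γ, hF⟩, rfl⟩

theorem ordinateWeight_eq (h : SparseZeros F) {γ : ℝ} (hγ : 0 < γ) :
    ordinateWeight F γ = ∑ β ∈ (h.finite_zerosAt hγ).toFinset,
      (analyticOrderNatAt F ⟨β, γ⟩ : ℝ) * lorentzWeight β γ :=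
  finsum_mem_eq_finite_toFinset_sum _ (h.finite_zerosAt hγ)

theorem ordinateWeight_pos (h : SparseZeros F) {γ : ℝ} (hγ : γ ∈ ordinates F) :
    0 < ordinateWeight F γ := by
  rw [h.ordinateWeight_eq hγ.1]
  refine Finset.sum_pos (fun β hβ => ?_) (by simpa using hγ.2)
  obtain ⟨h0, h1, hF⟩ := (Set.Finite.mem_toFinset _).1 hβ
  exact mul_pos (by exact_mod_cast h.order_pos ⟨β, γ⟩ h0 h1 hF) (lorentzWeight_pos h0 h1)

theorem strictMono_ordinate (h : SparseZeros F) (hinf : (ordinates F).Infinite) :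
    StrictMono (ordinate F) :=
  strictMono_nat_of_lt_succ fun k => (ordinate_mem_and_lt h.finite_ordinates hinf k).2

theorem ordinate_mem (h : SparseZeros F) (hinf : (ordinates F).Infinite) (k : ℕ) :
    ordinate F k ∈ ordinates F :=
  (ordinate_mem_and_lt h.finite_ordinates hinf k).1

theorem coeff_pos (h : SparseZeros F) (hinf : (ordinates F).Infinite) (k : ℕ) : 0 < coeff F k :=
  h.ordinateWeight_pos (h.ordinate_mem hinf k)

theorem summable_coeff (h : SparseZeros F) (hinf : (ordinates F).Infinite) :
    Summable (coeff F) := by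
  classical
  obtain ⟨B, hB⟩ := h.sum_le
  have hmono := h.strictMono_ordinate hinf
  have hpos : ∀ k, 0 < ordinate F k := fun k => (h.ordinate_mem hinf k).1
  set γ₀ := ordinate F 0 with hγ₀
  have hγ₀pos : 0 < γ₀ := hpos 0
  -- Chosen so that `2 / γ ^ 2 ≤ D / (3 + γ) ^ 2` for `γ ≥ γ₀`, since then `3 + γ ≤ (3 / γ₀ + 1) *
  -- γ`.
  set D : ℝ := 2 * (3 / γ₀ + 1) ^ 2 with hD
  have hterm : ∀ k, ∀ β : ℝ, 0 < β → β < 1 →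
      lorentzWeight β (ordinate F k) ≤ D / (3 + ordinate F k) ^ 2 := by
    intro k β h0 h1
    have hγ := hpos k
    have hge : γ₀ ≤ ordinate F k := hmono.monotone (Nat.zero_le k)
    refine (lorentzWeight_le h0 h1 hγ).trans ?_
    rw [div_le_div_iff₀ (by positivity) (by positivity), hD, mul_assoc, ← mul_pow]
    refine mul_le_mul_of_nonneg_left (pow_le_pow_left₀ (by positivity) ?_ 2) (by norm_num)
    rw [add_mul, one_mul]
    have : 3 ≤ 3 / γ₀ * ordinate F k := by
      rw [div_mul_eq_mul_div, le_div_iff₀ hγ₀pos]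
      linarith
    linarith
  refine summable_of_sum_range_le (c := D * B) (fun k => (h.coeff_pos hinf k).le) fun n => ?_
  set Z : Finset ℂ := (Finset.range n).biUnion fun k =>
    (h.finite_zerosAt (hpos k)).toFinset.image fun β => (⟨β, ordinate F k⟩ : ℂ) with hZ
  have hsum : ∑ ρ ∈ Z, (analyticOrderNatAt F ρ : ℝ) / (3 + ρ.im) ^ 2 =
      ∑ k ∈ Finset.range n, ∑ β ∈ (h.finite_zerosAt (hpos k)).toFinset,
        (analyticOrderNatAt F ⟨β, ordinate F k⟩ : ℝ) / (3 + ordinate F k) ^ 2 := by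
    rw [hZ, Finset.sum_biUnion]
    · refine Finset.sum_congr rfl fun k _ => ?_
      rw [Finset.sum_image]
      intro β _ β' _ hb
      exact congrArg Complex.re hb
    · intro i _ j _ hij
      refine Finset.disjoint_left.2 fun ρ h1 h2 => hij ?_
      obtain ⟨β, _, rfl⟩ := Finset.mem_image.1 h1
      obtain ⟨β', _, hb⟩ := Finset.mem_image.1 h2
      exact hmono.injective (congrArg Complex.im hb).symm
  have hZB := hB Z (by
    intro ρ hρ
    obtain ⟨k, _, hk⟩ := Finset.mem_biUnion.1 hρ
    obtain ⟨β, hβ, rfl⟩ := Finset.mem_image.1 hk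
    obtain ⟨h0, h1, _⟩ := (Set.Finite.mem_toFinset _).1 hβ
    exact ⟨h0, h1, hpos k⟩)
  rw [hsum] at hZB
  refine le_trans ?_ (mul_le_mul_of_nonneg_left hZB (by positivity : 0 ≤ D))
  rw [Finset.mul_sum]
  refine Finset.sum_le_sum fun k _ => ?_
  rw [coeff, h.ordinateWeight_eq (hpos k), Finset.mul_sum]
  refine Finset.sum_le_sum fun β hβ => ?_
  obtain ⟨h0, h1, _⟩ := (Set.Finite.mem_toFinset _).1 hβ
  calc _ ≤ (analyticOrderNatAt F ⟨β, ordinate F k⟩ : ℝ) * (D / (3 + ordinate F k) ^ 2) :=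
        mul_le_mul_of_nonneg_left (hterm k β h0 h1) (Nat.cast_nonneg _)
    _ = _ := by ring

end SparseZeros

end ordinates

/-! ### Sparsity of the zeros of Dirichlet `L`-functions -/

theorem DirichletCharacter.sparseZeros {N : ℕ} [NeZero N] (χ : DirichletCharacter ℂ N) :
    SparseZeros (DirichletCharacter.LFunction χ) := by
  have hd := differentiable_entireLFunction χ
  have hgr := moderateGrowth_entireLFunction χ
  have h2 := entireLFunction_two_ne_zero χ
  have hne : ∀ {ρ : ℂ}, ρ.re < 1 → ρ ≠ 1 := fun h h' => by simp [h'] at h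
  -- It follows that `1 + ‖ρ - 2‖ ≤ 3 + ρ.im`, which is the source of the `3` in
  -- `SparseZeros.sum_le`.
  have hnorm : ∀ {ρ : ℂ}, 0 < ρ.re → ρ.re < 1 → 0 < ρ.im → ‖ρ - 2‖ ≤ 2 + ρ.im := by
    intro ρ h0 h1 him
    have h := Complex.norm_le_abs_re_add_abs_im (ρ - 2)
    have e1 : (ρ - 2).re = ρ.re - 2 := by simp
    have e2 : (ρ - 2).im = ρ.im := by simp
    rw [e1, e2, abs_of_pos him, abs_of_nonpos (by linarith)] at h
    linarith
  refine ⟨fun T => ?_, fun ρ h0 h1 hF => ?_, ?_⟩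
  · refine (hgr.finite_zeros hd h2 (2 + T)).subset ?_
    rintro ρ ⟨h0, h1, him, hT, hF⟩
    exact ⟨(LFunction_eq_zero_iff χ h0 (hne h1)).1 hF, (hnorm h0 h1 him).trans (by linarith)⟩
  · rw [analyticOrderNatAt_LFunction χ h0 (hne h1)]
    exact analyticOrderNatAt_pos_of_entire hd h2 ((LFunction_eq_zero_iff χ h0 (hne h1)).1 hF)
  · obtain ⟨B, hB⟩ := hgr.sum_order_div_sq_le hd h2
    refine ⟨B, fun Z hZ => le_trans (Finset.sum_le_sum fun ρ hρ => ?_) (hB Z)⟩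
    obtain ⟨h0, h1, him⟩ := hZ ρ hρ
    rw [analyticOrderNatAt_LFunction χ h0 (hne h1)]
    have := hnorm h0 h1 him
    refine div_le_div_of_nonneg_left (Nat.cast_nonneg _) (by positivity) ?_
    exact pow_le_pow_left₀ (by positivity) (by linarith) 2

open ProbabilityTheory

/-! ### Equidistribution of linear flows on tori -/

section Torus

variable {ι : Type*}

/-- The monomial character of the torus with exponents `n`. -/
noncomputable def torusChar (n : ι →₀ ℤ) : C(ι → UnitAddCircle, ℂ) where
  toFun θ := n.prod fun i k => fourier k (θ i)
  continuous_toFun := by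
    unfold Finsupp.prod
    fun_prop

theorem torusChar_apply (n : ι →₀ ℤ) (θ : ι → UnitAddCircle) :
    torusChar n θ = n.prod fun i k => fourier k (θ i) := rfl

theorem torusChar_add (m n : ι →₀ ℤ) : torusChar (m + n) = torusChar m * torusChar n := by
  classical
  ext θ
  rw [ContinuousMap.mul_apply, torusChar_apply, torusChar_apply, torusChar_apply]
  exact Finsupp.prod_add_index' (fun i => fourier_zero) fun i a b => fourier_add

theorem torusChar_neg (n : ι →₀ ℤ) : torusChar (-n) = star (torusChar n) := by
  ext θ
  rw [ContinuousMap.star_apply, torusChar_apply, torusChar_apply,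
    Finsupp.prod_neg_index (h := fun i k => fourier k (θ i)) (fun i => fourier_zero), Finsupp.prod, Finsupp.prod, star_prod]
  exact Finset.prod_congr rfl fun i _ => fourier_neg

theorem torusChar_zero : torusChar (0 : ι →₀ ℤ) = 1 := by
  ext θ
  simp [torusChar_apply]

theorem torusChar_single (i : ι) (k : ℤ) (θ : ι → UnitAddCircle) :
    torusChar (Finsupp.single i k) θ = fourier k (θ i) :=
  Finsupp.prod_single_index (h := fun i k => fourier k (θ i)) fourier_zero

/-- Stone–Weierstrass: characters are closed under products and conjugation, and the coordinate
characters separate points. -/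
theorem span_torusChar_dense :
    (Submodule.span ℂ (Set.range (torusChar (ι := ι)))).topologicalClosure = ⊤ := by
  classical
  let A : StarSubalgebra ℂ C(ι → UnitAddCircle, ℂ) :=
    { toSubalgebra := Algebra.adjoin ℂ (Set.range torusChar)
      star_mem' := by
        change Algebra.adjoin ℂ (Set.range torusChar) ≤ star (Algebra.adjoin ℂ (Set.range torusChar))
        refine Algebra.adjoin_le ?_
        rintro _ ⟨n, rfl⟩
        exact Algebra.subset_adjoin ⟨-n, torusChar_neg n⟩ }
  have hspan : A.toSubalgebra.toSubmodule = Submodule.span ℂ (Set.range torusChar) := by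
    apply Algebra.adjoin_eq_span_of_subset
    refine .trans (fun x => Submonoid.closure_induction (fun _ => _root_.id)
      ⟨0, torusChar_zero⟩ ?_) Submodule.subset_span
    rintro _ _ _ _ ⟨m, rfl⟩ ⟨n, rfl⟩
    exact ⟨m + n, torusChar_add m n⟩
  have hsep : A.SeparatesPoints := by
    intro x y hxy
    obtain ⟨i, hi⟩ := Function.ne_iff.1 hxy
    refine ⟨_, ⟨torusChar (Finsupp.single i 1), Algebra.subset_adjoin ⟨_, rfl⟩, rfl⟩, ?_⟩
    simp only [torusChar_single, fourier_one]
    intro h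
    exact hi (AddCircle.injective_toCircle one_ne_zero (Subtype.ext h))
  have htop := ContinuousMap.starSubalgebra_topologicalClosure_eq_top_of_separatesPoints A hsep
  rw [← hspan]
  exact congr_arg (Subalgebra.toSubmodule <| StarSubalgebra.toSubalgebra ·) htop

/-- The Haar probability measure of the torus. -/
noncomputable def torusMeasure (ι : Type*) : Measure (ι → UnitAddCircle) :=
  Measure.infinitePi fun _ => AddCircle.haarAddCircle

instance : IsProbabilityMeasure (torusMeasure ι) := by
  unfold torusMeasure
  infer_instance

/-- Translation by half a period of the character changes its sign and preserves Haar measure. -/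
theorem integral_fourier_haar {k : ℤ} (hk : k ≠ 0) :
    ∫ θ : UnitAddCircle, fourier k θ ∂AddCircle.haarAddCircle = 0 :=
  integral_eq_zero_of_add_right_eq_neg (μ := AddCircle.haarAddCircle)
    (fourier_add_half_inv_index hk (by norm_num))

/-- A character depends on finitely many coordinates, so its integral factors, and any coordinate in
the support gives a zero factor. -/
theorem integral_torusChar {n : ι →₀ ℤ} (hn : n ≠ 0) : ∫ θ, torusChar n θ ∂torusMeasure ι = 0 := by
  have h1 : ∀ θ, torusChar n θ =
      (fun y : n.support → UnitAddCircle => ∏ i : n.support, fourier (n i) (y i)) (n.support.restrict θ) := by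
    intro θ
    rw [torusChar_apply, Finsupp.prod, ← Finset.prod_coe_sort]
    rfl
  rw [integral_congr_ae (ae_of_all _ h1), torusMeasure]
  refine (integral_restrict_infinitePi (μ := fun _ : ι => AddCircle.haarAddCircle)
    (f := fun y : n.support → UnitAddCircle => ∏ i : n.support, fourier (n i) (y i))
    (Continuous.aestronglyMeasurable (by fun_prop))).trans ?_
  rw [integral_fintype_prod_eq_prod (fun (i : n.support) θ => fourier (n i) θ)]
  obtain ⟨i, hi⟩ := Finsupp.support_nonempty_iff.2 hn
  exact Finset.prod_eq_zero (Finset.mem_univ ⟨i, hi⟩)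
    (integral_fourier_haar (Finsupp.mem_support_iff.1 hi))

/-- The linear flow with frequencies `e` on the torus. -/
noncomputable def torusFlow (e : ι → ℝ) (δ : ℝ) : ι → UnitAddCircle :=
  fun i => ((e i * δ / (2 * Real.pi) : ℝ) : UnitAddCircle)

theorem continuous_torusFlow (e : ι → ℝ) : Continuous (torusFlow e) := by
  refine continuous_pi fun i => (AddCircle.continuous_mk' 1).comp (by fun_prop)

theorem fourier_torusFlow (e : ι → ℝ) (δ : ℝ) (i : ι) (k : ℤ) :
    fourier k (torusFlow e δ i) = Complex.exp (Complex.I * (k * e i * δ)) := by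
  rw [torusFlow, fourier_coe_apply]
  congr 1
  have : (Real.pi : ℂ) ≠ 0 := by exact_mod_cast Real.pi_ne_zero
  push_cast
  field_simp

theorem torusChar_torusFlow (e : ι → ℝ) (n : ι →₀ ℤ) (δ : ℝ) : torusChar n (torusFlow e δ) =
    Complex.exp (Complex.I * (Finsupp.linearCombination ℤ e n : ℝ) * δ) := by
  rw [torusChar_apply, Finsupp.prod]
  simp_rw [fourier_torusFlow]
  rw [← Complex.exp_sum, Finsupp.linearCombination_apply, Finsupp.sum]
  congr 1
  push_cast [zsmul_eq_mul]
  rw [Finset.mul_sum, Finset.sum_mul]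
  exact Finset.sum_congr rfl fun i _ => by ring

/-- The average of `h` over `[-T, T]`. -/
noncomputable def cesaroMean (h : ℝ → ℂ) (T : ℝ) : ℂ := (1 / (2 * T) : ℝ) * ∫ δ in (-T)..T, h δ

theorem norm_cesaroMean_le {h : ℝ → ℂ} {C : ℝ} (hC : ∀ δ, ‖h δ‖ ≤ C) (T : ℝ) :
    ‖cesaroMean h T‖ ≤ C := by
  have hC0 : 0 ≤ C := (norm_nonneg _).trans (hC 0)
  have h1 := intervalIntegral.norm_integral_le_of_norm_le_const (a := -T) (b := T)
    (fun x _ => hC x)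
  rw [cesaroMean, norm_mul, Complex.norm_real, Real.norm_eq_abs]
  rcases eq_or_ne T 0 with rfl | hT
  · simpa using hC0
  · calc |1 / (2 * T)| * ‖∫ δ in (-T)..T, h δ‖ ≤ |1 / (2 * T)| * (C * |T - -T|) := by gcongr
      _ = C := by
        rw [sub_neg_eq_add, ← two_mul, abs_div, abs_one]
        have : |2 * T| ≠ 0 := by simpa using hT
        field_simp

theorem cesaroMean_sub {h g : ℝ → ℂ} (hh : Continuous h) (hg : Continuous g) (T : ℝ) :
    cesaroMean (fun δ => h δ - g δ) T = cesaroMean h T - cesaroMean g T := by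
  rw [cesaroMean, intervalIntegral.integral_sub (hh.intervalIntegrable _ _)
    (hg.intervalIntegrable _ _), mul_sub]
  rfl

theorem tendsto_cesaroMean_exp {l : ℝ} (hl : l ≠ 0) :
    Tendsto (cesaroMean fun δ => Complex.exp (Complex.I * l * δ)) atTop (𝓝 0) := by
  have hl' : Complex.I * (l : ℂ) ≠ 0 := mul_ne_zero Complex.I_ne_zero (by exact_mod_cast hl)
  have hb : ∀ᶠ T in atTop, ‖cesaroMean (fun δ => Complex.exp (Complex.I * l * δ)) T‖ ≤
      (1 / |l|) * T⁻¹ := by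
    filter_upwards [eventually_gt_atTop 0] with T hT
    rw [cesaroMean, integral_exp_mul_complex hl', norm_mul, norm_div, Complex.norm_real,
      norm_mul, Complex.norm_I, one_mul, Complex.norm_real, Real.norm_eq_abs, Real.norm_eq_abs]
    have h2 : ‖Complex.exp (Complex.I * l * (T : ℝ)) - Complex.exp (Complex.I * l * ((-T : ℝ) : ℂ))‖
        ≤ 2 := by
      refine (norm_sub_le _ _).trans ?_
      have h3 : ∀ x : ℝ, ‖Complex.exp (Complex.I * l * (x : ℝ))‖ = 1 := by
        intro x
        rw [mul_assoc, mul_comm, ← Complex.ofReal_mul, Complex.norm_exp_ofReal_mul_I]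
      rw [h3, h3]
      norm_num
    have h4 : |1 / (2 * T)| = T⁻¹ / 2 := by
      rw [abs_of_pos (by positivity)]
      field_simp
    have hl0 : 0 < |l| := abs_pos.2 hl
    rw [h4]
    calc _ ≤ T⁻¹ / 2 * (2 / |l|) := by gcongr
      _ = _ := by ring
  refine squeeze_zero_norm' hb ?_
  simpa using tendsto_inv_atTop_zero.const_mul (1 / |l|)

theorem tendsto_cesaroMean_torusChar {e : ι → ℝ} (he : LinearIndependent ℤ e) (n : ι →₀ ℤ) :
    Tendsto (cesaroMean fun δ => torusChar n (torusFlow e δ)) atTop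
      (𝓝 (∫ θ, torusChar n θ ∂torusMeasure ι)) := by
  rcases eq_or_ne n 0 with rfl | hn
  · simp only [torusChar_zero, ContinuousMap.one_apply, integral_const, probReal_univ, one_smul]
    refine tendsto_const_nhds.congr' ?_
    filter_upwards [eventually_gt_atTop 0] with T hT
    rw [cesaroMean, intervalIntegral.integral_const]
    simp only [Complex.real_smul, mul_one, ← Complex.ofReal_mul]
    rw [show 1 / (2 * T) * (T - -T) = 1 by field_simp; ring, Complex.ofReal_one]
  · rw [integral_torusChar hn]
    simp_rw [torusChar_torusFlow]
    -- Independence of the frequencies enters here: a nontrivial character has nonzero frequency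
    -- along the flow.
    refine tendsto_cesaroMean_exp fun h => hn ?_
    exact (linearIndependent_iff.1 he) n h

theorem norm_integral_torusMeasure_le (h : C(ι → UnitAddCircle, ℂ)) :
    ‖∫ θ, h θ ∂torusMeasure ι‖ ≤ ‖h‖ := by
  have := norm_integral_le_of_norm_le_const (μ := torusMeasure ι)
    (ae_of_all _ fun θ => h.norm_coe_le_norm θ)
  simpa using this

theorem integrable_torusMeasure [Countable ι] {E : Type*} [NormedAddCommGroup E]
    [SecondCountableTopology E] (h : C(ι → UnitAddCircle, E)) :
    Integrable h (torusMeasure ι) :=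
  h.continuous.integrable_of_hasCompactSupport (HasCompactSupport.of_compactSpace _)

/-- **Weyl's equidistribution theorem** for linear flows with independent frequencies. -/
theorem tendsto_cesaroMean_torusFlow [Countable ι] {e : ι → ℝ} (he : LinearIndependent ℤ e)
    (h : C(ι → UnitAddCircle, ℂ)) :
    Tendsto (cesaroMean fun δ => h (torusFlow e δ)) atTop (𝓝 (∫ θ, h θ ∂torusMeasure ι)) := by
  have hcont : ∀ h : C(ι → UnitAddCircle, ℂ), Continuous fun δ => h (torusFlow e δ) :=
    fun h => h.continuous.comp (continuous_torusFlow e)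
  have hF : ∀ T, LipschitzWith 1 fun h : C(ι → UnitAddCircle, ℂ) =>
      cesaroMean (fun δ => h (torusFlow e δ)) T := by
    intro T
    refine LipschitzWith.of_dist_le_mul fun h g => ?_
    rw [dist_eq_norm, dist_eq_norm, ← cesaroMean_sub (hcont h) (hcont g), NNReal.coe_one, one_mul]
    exact norm_cesaroMean_le (fun δ => (h - g).norm_coe_le_norm _) T
  have hI : LipschitzWith 1 fun h : C(ι → UnitAddCircle, ℂ) => ∫ θ, h θ ∂torusMeasure ι := by
    refine LipschitzWith.of_dist_le_mul fun h g => ?_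
    rw [dist_eq_norm, dist_eq_norm, ← integral_sub (integrable_torusMeasure h)
      (integrable_torusMeasure g), NNReal.coe_one, one_mul]
    exact norm_integral_torusMeasure_le (h - g)
  -- The means are 1-Lipschitz in `h` uniformly in `T`, and so is the integral; convergence
  -- therefore passes from a dense subspace to all continuous functions.
  have hclosed : IsClosed {h : C(ι → UnitAddCircle, ℂ) |
      Tendsto (fun T => cesaroMean (fun δ => h (torusFlow e δ)) T) atTop
        (𝓝 (∫ θ, h θ ∂torusMeasure ι))} :=
    (LipschitzWith.uniformEquicontinuous _ 1 hF).equicontinuous.isClosed_setOfPred_tendsto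
      hI.continuous
  have hspan : (Submodule.span ℂ (Set.range (torusChar (ι := ι))) : Set C(ι → UnitAddCircle, ℂ)) ⊆
      {h | Tendsto (fun T => cesaroMean (fun δ => h (torusFlow e δ)) T) atTop
        (𝓝 (∫ θ, h θ ∂torusMeasure ι))} := by
    intro h hh
    induction hh using Submodule.span_induction with
    | mem h hh =>
      obtain ⟨n, rfl⟩ := hh
      exact tendsto_cesaroMean_torusChar he n
    | zero => simp [cesaroMean]
    | add h g _ _ hh hg =>
      have := hh.add hg
      rw [← integral_add (integrable_torusMeasure h) (integrable_torusMeasure g)] at this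
      refine this.congr fun T => ?_
      simp only [cesaroMean]
      rw [← mul_add, ← intervalIntegral.integral_add ((hcont h).intervalIntegrable _ _)
        ((hcont g).intervalIntegrable _ _)]
      rfl
    | smul a h _ hh =>
      have := hh.const_mul a
      rw [← integral_const_mul] at this
      refine this.congr fun T => ?_
      simp only [cesaroMean]
      rw [mul_left_comm, ← intervalIntegral.integral_const_mul]
      rfl
  have hmem : h ∈ (Submodule.span ℂ (Set.range (torusChar (ι := ι)))).topologicalClosure := by
    rw [span_torusChar_dense]
    trivial
  exact hclosed.closure_subset_iff.2 hspan hmem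

theorem isCesaroDistribution_comp_torusFlow [Countable ι] {e : ι → ℝ} (he : LinearIndependent ℤ e)
    (s : C(ι → UnitAddCircle, ℝ)) :
    IsCesaroDistribution (fun δ => s (torusFlow e δ)) ((torusMeasure ι).map s) := by
  refine ⟨Measure.isProbabilityMeasure_map s.continuous.aemeasurable, fun g => ?_⟩
  rw [integral_map s.continuous.aemeasurable g.continuous.aestronglyMeasurable]
  let h : C(ι → UnitAddCircle, ℂ) := ⟨fun θ => ((g (s θ) : ℝ) : ℂ), by fun_prop⟩
  have h1 := (Complex.continuous_re.tendsto _).comp (tendsto_cesaroMean_torusFlow he h)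
  have h2 : (∫ θ, h θ ∂torusMeasure ι) = ((∫ θ, g (s θ) ∂torusMeasure ι : ℝ) : ℂ) :=
    integral_ofReal
  rw [h2, Complex.ofReal_re] at h1
  refine h1.congr fun T => ?_
  have h3 : (∫ δ in (-T)..T, h (torusFlow e δ)) =
      ((∫ δ in (-T)..T, g (s (torusFlow e δ)) : ℝ) : ℂ) := intervalIntegral.integral_ofReal
  rw [Function.comp_apply, cesaroMean, h3, ← Complex.ofReal_mul, Complex.ofReal_re]

/-- The cosine on the circle `ℝ / ℤ`. -/
noncomputable def circleCos : C(UnitAddCircle, ℝ) := ⟨fun θ => (fourier 1 θ).re, by fun_prop⟩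

theorem circleCos_coe (x : ℝ) : circleCos (x : UnitAddCircle) = Real.cos (2 * Real.pi * x) := by
  change (fourier 1 (x : UnitAddCircle)).re = _
  rw [fourier_coe_apply, ← Complex.exp_ofReal_mul_I_re]
  congr 2
  push_cast
  ring

/-- The Bessel function `J₀`, as the characteristic function of the cosine of a uniform angle. -/
noncomputable def besselZero (x : ℝ) : ℂ :=
  ∫ θ : UnitAddCircle, Complex.exp (x * circleCos θ * Complex.I) ∂AddCircle.haarAddCircle

theorem charFun_map_mul_circleCos (i : ι) (b t : ℝ) :
    charFun ((torusMeasure ι).map fun θ => b * circleCos (θ i)) t = besselZero (b * t) := by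
  have h1 : (torusMeasure ι).map (fun θ => b * circleCos (θ i)) =
      (AddCircle.haarAddCircle : Measure UnitAddCircle).map fun x => b * circleCos x := by
    rw [← Measure.infinitePi_map_eval (fun _ : ι => (AddCircle.haarAddCircle :
      Measure UnitAddCircle)) i, Measure.map_map (by fun_prop) (by fun_prop)]
    rfl
  rw [h1, charFun_apply_real, integral_map (by fun_prop) (by fun_prop), besselZero]
  congr 1 with θ
  push_cast
  ring_nf

/-- Distinct coordinates are independent under Haar measure. The head `u` is an arbitrary continuous
function of its block, so relations among the head frequencies do no harm. -/
theorem charFun_head_add_sum {α : Type*} [Finite α] (u : C(α → UnitAddCircle, ℝ)) (b : ℕ → ℝ)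
    (m : ℕ) (t : ℝ) :
    charFun ((torusMeasure (α ⊕ ℕ)).map fun θ => u (fun a => θ (Sum.inl a)) +
      ∑ j ∈ Finset.range m, b j * circleCos (θ (Sum.inr j))) t =
    charFun ((torusMeasure (α ⊕ ℕ)).map fun θ => u (fun a => θ (Sum.inl a))) t *
      ∏ j ∈ Finset.range m, besselZero (b j * t) := by
  classical
  have := Fintype.ofFinite α
  have hind : iIndepFun (fun (i : α ⊕ ℕ) (θ : α ⊕ ℕ → UnitAddCircle) => θ i)
      (torusMeasure (α ⊕ ℕ)) :=
    iIndepFun_infinitePi (X := fun _ x => x) fun _ => measurable_id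
  have hmeas : ∀ i : α ⊕ ℕ, Measurable fun θ : α ⊕ ℕ → UnitAddCircle => θ i :=
    fun i => measurable_pi_apply i
  let S : Finset (α ⊕ ℕ) := Finset.univ.map Function.Embedding.inl
  let R : Finset (α ⊕ ℕ) := (Finset.range m).map Function.Embedding.inr
  have hdisj : Disjoint S R := by
    rw [Finset.disjoint_left]
    intro i hi hi'
    simp only [S, R, Finset.mem_map] at hi hi'
    obtain ⟨a, _, rfl⟩ := hi
    obtain ⟨j, _, hj⟩ := hi'
    simp at hj
  have h1 := hind.indepFun_finset S R hdisj hmeas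
  have hmemS : ∀ a : α, Sum.inl a ∈ S := fun a => by simp [S]
  have hmemR : ∀ j : Finset.range m, Sum.inr (j : ℕ) ∈ R := fun j => by
    have := j.2
    simp only [R, Finset.mem_map]
    exact ⟨j, this, rfl⟩
  have h2 := h1.comp (φ := fun y : S → UnitAddCircle => u fun a => y ⟨Sum.inl a, hmemS a⟩)
    (ψ := fun y : R → UnitAddCircle => ∑ j : Finset.range m, b j * circleCos (y ⟨Sum.inr j, hmemR j⟩))
    (Continuous.measurable (by fun_prop)) (Continuous.measurable (by fun_prop))
  have h3 := IndepFun.charFun_map_fun_add_eq_mul (Continuous.aemeasurable (by fun_prop))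
    (Continuous.aemeasurable (by fun_prop)) h2
  have hsum : ∀ θ : α ⊕ ℕ → UnitAddCircle, ∑ j : Finset.range m, b j * circleCos (θ (Sum.inr (j : ℕ)))
      = ∑ j ∈ Finset.range m, b j * circleCos (θ (Sum.inr j)) := fun θ =>
    Finset.sum_coe_sort (Finset.range m) fun j => b j * circleCos (θ (Sum.inr j))
  simp only [Function.comp_def, hsum] at h3
  rw [h3, Pi.mul_apply]
  congr 1
  have h4 : iIndepFun (fun (j : ℕ) (θ : α ⊕ ℕ → UnitAddCircle) => b j * circleCos (θ (Sum.inr j)))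
      (torusMeasure (α ⊕ ℕ)) :=
    (hind.precomp (g := Sum.inr) Sum.inr_injective).comp (fun j x => b j * circleCos x)
      fun j => Continuous.measurable (by fun_prop)
  rw [(h4.restrict (Finset.range m)).charFun_map_fun_finsetSum_eq_prod fun j _ => Continuous.aemeasurable (by fun_prop),
    Finset.prod_apply]
  exact Finset.prod_congr rfl fun j _ => charFun_map_mul_circleCos _ _ _

end Torus

/-! ### Fourier inversion for probability measures -/

section Inversion

open scoped FourierTransform SchwartzMap ContDiff

/-- The Fourier transform `ξ ↦ ∫ exp (-2πi x ξ) dμ(x)` of a measure. -/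
noncomputable def fourierMeasure (μ : Measure ℝ) (ξ : ℝ) : ℂ := charFun μ (-(2 * Real.pi) * ξ)

/-- The complex-valued density provided by Fourier inversion. -/
noncomputable def inversionDensity (μ : Measure ℝ) : ℝ → ℂ := 𝓕⁻ (fourierMeasure μ)

variable {μ : Measure ℝ}

theorem fourierMeasure_eq (μ : Measure ℝ) (ξ : ℝ) : fourierMeasure μ ξ =
    VectorFourier.fourierIntegral Real.fourierChar μ (innerₗ ℝ).flip 1 ξ := by
  rw [fourierMeasure, charFun_apply_real, VectorFourier.fourierIntegral]
  congr 1 with x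
  simp only [Circle.smul_def, Real.fourierChar_apply, smul_eq_mul, Pi.one_apply, mul_one]
  congr 1
  simp
  ring

theorem integrable_fourierMeasure (h : Integrable (charFun μ)) : Integrable (fourierMeasure μ) :=
  h.comp_mul_left' (neg_ne_zero.2 (by positivity))

theorem continuous_inversionDensity (h : Integrable (charFun μ)) :
    Continuous (inversionDensity μ) := by
  -- The inverse Fourier transform is the Fourier integral for the pairing `-innerₗ ℝ`.
  have h1 := VectorFourier.fourierIntegral_continuous (L := -innerₗ ℝ) Real.continuous_fourierChar
    (by simp; fun_prop) (integrable_fourierMeasure h)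
  exact h1

/-- Conjugating a characteristic function amounts to `t ↦ -t`, which the substitution `ξ ↦ -ξ`
undoes. So taking the real part as density loses nothing. -/
theorem conj_inversionDensity (x : ℝ) :
    (starRingEnd ℂ) (inversionDensity μ x) = inversionDensity μ x := by
  rw [inversionDensity, Real.fourierInv_eq', ← integral_conj]
  conv_rhs => rw [← integral_neg_eq_self]
  congr 1 with ξ
  rw [smul_eq_mul, smul_eq_mul, map_mul, ← Complex.exp_conj, fourierMeasure, fourierMeasure,
    ← charFun_neg]
  congr 2
  · simp only [map_mul, Complex.conj_ofReal, Complex.conj_I, inner_neg_left]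
    push_cast
    ring
  · ring

theorem ofReal_re_inversionDensity (x : ℝ) :
    ((inversionDensity μ x).re : ℂ) = inversionDensity μ x :=
  Complex.conj_eq_iff_re.1 (conj_inversionDensity x)

theorem inversionDensity_zero :
    inversionDensity μ 0 = (1 / (2 * Real.pi)) * ∫ t, charFun μ t := by
  rw [inversionDensity, Real.fourierInv_eq']
  simp only [inner_zero_right, mul_zero, Complex.ofReal_zero, zero_mul, Complex.exp_zero, one_smul]
  unfold fourierMeasure
  rw [Measure.integral_comp_mul_left, abs_inv, abs_neg, abs_of_pos (by positivity),
    Complex.real_smul]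
  push_cast
  ring

/-- Write `g = 𝓕 (𝓕⁻ g)`, move `𝓕` onto `μ` by Fubini, then move `𝓕⁻` from `g` onto the transform of
`μ`. -/
theorem integral_schwartz_eq [IsProbabilityMeasure μ] (h : Integrable (charFun μ)) (g : 𝓢(ℝ, ℂ)) :
    ∫ x, g x ∂μ = ∫ x, g x * inversionDensity μ x := by
  have h1 : ∫ x, g x ∂μ = ∫ ξ, (𝓕⁻ g) ξ * fourierMeasure μ ξ := by
    have := VectorFourier.integral_fourierIntegral_smul_eq_flip (e := Real.fourierChar)
      (μ := volume) (ν := μ) (L := innerₗ ℝ) (f := (𝓕⁻ g : 𝓢(ℝ, ℂ))) (g := (1 : ℝ → ℂ))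
      Real.continuous_fourierChar continuous_inner (𝓕⁻ g : 𝓢(ℝ, ℂ)).integrable (integrable_const 1)
    simp_rw [← fourierMeasure_eq] at this
    simp only [smul_eq_mul, Pi.one_apply, mul_one] at this
    rw [← this]
    congr 1 with x
    have h2 : (𝓕 (𝓕⁻ g : 𝓢(ℝ, ℂ)) : 𝓢(ℝ, ℂ)) x = g x := by simp
    rw [← h2]
    rfl
  have h3 : ∫ ξ, (𝓕⁻ g) ξ * fourierMeasure μ ξ = ∫ x, g x * inversionDensity μ x := by
    have := VectorFourier.integral_fourierIntegral_smul_eq_flip (e := Real.fourierChar)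
      (μ := volume) (ν := volume) (L := -innerₗ ℝ) (f := g) (g := fourierMeasure μ)
      Real.continuous_fourierChar (by simp; fun_prop) g.integrable
      (integrable_fourierMeasure h)
    have e1 : ∀ ξ, VectorFourier.fourierIntegral Real.fourierChar volume (-innerₗ ℝ) g ξ =
        (𝓕⁻ g) ξ := fun ξ => by
      rw [SchwartzMap.fourierInv_coe]
      rfl
    have e2 : ∀ x, VectorFourier.fourierIntegral Real.fourierChar volume (-innerₗ ℝ).flip
        (fourierMeasure μ) x = inversionDensity μ x := fun x => by
      rw [inversionDensity, Real.fourierInv_eq, VectorFourier.fourierIntegral]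
      simp [mul_comm]
    simpa only [e1, e2, smul_eq_mul] using this
  rw [h1, h3]

theorem integral_bump_eq [IsProbabilityMeasure μ] (h : Integrable (charFun μ)) {c : ℝ}
    (g : ContDiffBump c) : ∫ x, g x ∂μ = ∫ x, g x * (inversionDensity μ x).re := by
  have hcs : HasCompactSupport fun x => ((g x : ℝ) : ℂ) :=
    g.hasCompactSupport.comp_left (g := ((↑) : ℝ → ℂ)) Complex.ofReal_zero
  have hcd : ContDiff ℝ ∞ fun x => ((g x : ℝ) : ℂ) := Complex.ofRealCLM.contDiff.comp g.contDiff
  have h1 := integral_schwartz_eq h (hcs.toSchwartzMap hcd)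
  have h2 : ∀ x, (hcs.toSchwartzMap hcd) x = ((g x : ℝ) : ℂ) := fun x => rfl
  have h3 : ∀ x, ((g x : ℝ) : ℂ) * inversionDensity μ x =
      ((g x * (inversionDensity μ x).re : ℝ) : ℂ) := fun x => by
    rw [Complex.ofReal_mul, ofReal_re_inversionDensity]
  simp_rw [h2, h3] at h1
  rw [integral_complex_ofReal, integral_complex_ofReal] at h1
  exact_mod_cast h1

/-- If the continuous density were negative at a point, a bump supported near that point would have
negative integral against `μ`. -/
theorem inversionDensity_nonneg [IsProbabilityMeasure μ] (h : Integrable (charFun μ)) (x : ℝ) :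
    0 ≤ (inversionDensity μ x).re := by
  by_contra hneg
  push Not at hneg
  have hc : Continuous fun x => (inversionDensity μ x).re :=
    Complex.continuous_re.comp (continuous_inversionDensity h)
  obtain ⟨ε, hε, hball⟩ := Metric.eventually_nhds_iff_ball.1
    ((hc.tendsto x).eventually (gt_mem_nhds hneg))
  let g : ContDiffBump x := ⟨ε / 2, ε, by positivity, by linarith⟩
  have h1 := integral_bump_eq h g
  have h2 : 0 ≤ ∫ x, g x ∂μ := integral_nonneg fun y => g.nonneg
  have h3 : ∫ y, g y * (inversionDensity μ y).re < 0 := by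
    rw [← neg_pos, ← integral_neg]
    have hcont : Continuous fun y => -(g y * (inversionDensity μ y).re) :=
      (g.continuous.mul hc).neg
    refine hcont.integral_pos_of_hasCompactSupport_nonneg_nonzero
      (HasCompactSupport.neg g.hasCompactSupport.mul_right) (fun y => ?_) (x := x) ?_
    · by_cases hy : y ∈ Metric.ball x ε
      · have := hball y hy
        have h4 := g.nonneg (x := y)
        simp only [Pi.zero_apply]
        nlinarith
      · have : g y = 0 := g.zero_of_le_dist (by simpa [g] using hy)
        simp [this]
    · have h5 : g x = 1 := g.one_of_mem_closedBall (by simp [g.rIn_pos.le])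
      rw [h5, one_mul]
      exact neg_ne_zero.2 hneg.ne
  linarith

/-- Bumps equal to 1 on growing intervals show that the integral of the density over each of them is
at most the total mass 1. -/
theorem integrable_inversionDensity [IsProbabilityMeasure μ] (h : Integrable (charFun μ)) :
    Integrable fun x => (inversionDensity μ x).re := by
  have hc : Continuous fun x => (inversionDensity μ x).re :=
    Complex.continuous_re.comp (continuous_inversionDensity h)
  have hcover : AECover volume atTop fun n : ℕ => Set.Icc (-((n : ℝ) + 1)) ((n : ℝ) + 1) := by
    refine aecover_Icc ?_ ?_
    · exact tendsto_neg_atTop_atBot.comp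
        (tendsto_atTop_add_const_right _ _ tendsto_natCast_atTop_atTop)
    · exact tendsto_atTop_add_const_right _ _ tendsto_natCast_atTop_atTop
  refine hcover.integrable_of_integral_bounded_of_nonneg_ae 1
    (fun n => hc.continuousOn.integrableOn_compact isCompact_Icc)
    (ae_of_all _ (inversionDensity_nonneg h)) (Eventually.of_forall fun n => ?_)
  let g : ContDiffBump (0 : ℝ) := ⟨(n : ℝ) + 1, (n : ℝ) + 2, by positivity, by linarith⟩
  have hint : Integrable fun x => g x * (inversionDensity μ x).re :=
    (g.continuous.mul hc).integrable_of_hasCompactSupport g.hasCompactSupport.mul_right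
  have h0 : ∀ x, 0 ≤ g x * (inversionDensity μ x).re := fun x =>
    mul_nonneg g.nonneg (inversionDensity_nonneg h x)
  calc ∫ x in Set.Icc (-((n : ℝ) + 1)) ((n : ℝ) + 1), (inversionDensity μ x).re
      = ∫ x in Set.Icc (-((n : ℝ) + 1)) ((n : ℝ) + 1), g x * (inversionDensity μ x).re := by
        refine setIntegral_congr_fun measurableSet_Icc fun x hx => ?_
        have : g x = 1 := g.one_of_mem_closedBall (by
          rw [Metric.mem_closedBall, dist_zero_right, Real.norm_eq_abs, abs_le]
          exact hx)
        simp [this]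
    _ ≤ ∫ x, g x * (inversionDensity μ x).re :=
        setIntegral_le_integral hint (ae_of_all _ h0)
    _ = ∫ x, g x ∂μ := (integral_bump_eq h g).symm
    _ ≤ ∫ _, 1 ∂μ := integral_mono_of_nonneg (ae_of_all _ fun x => g.nonneg)
        (integrable_const 1) (ae_of_all _ fun x => g.le_one)
    _ = 1 := by simp

/-- A probability measure with integrable characteristic function has a continuous density. -/
theorem hasContinuousDensity_of_integrable_charFun [IsProbabilityMeasure μ]
    (h : Integrable (charFun μ)) :
    HasContinuousDensity μ fun x => (inversionDensity μ x).re := by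
  have hc : Continuous fun x => (inversionDensity μ x).re :=
    Complex.continuous_re.comp (continuous_inversionDensity h)
  have hint := integrable_inversionDensity h
  refine ⟨hc, inversionDensity_nonneg h, ?_⟩
  have hfin : IsFiniteMeasure
      (volume.withDensity fun x => ENNReal.ofReal (inversionDensity μ x).re) :=
    isFiniteMeasure_withDensity_ofReal hint.2
  -- Schwartz functions have shown the density to be nonnegative and integrable, so Fourier
  -- inversion applies to the transform of `μ` and identifies the two characteristic functions.
  refine Measure.ext_of_charFun (funext fun t => ?_)
  have hcont : Continuous (fourierMeasure μ) := continuous_charFun.comp (by fun_prop)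
  have hdint : Integrable (inversionDensity μ) := by
    have := hint.ofReal (𝕜 := ℂ)
    simpa only [Complex.coe_algebraMap, RCLike.ofReal_eq_complex_ofReal, ofReal_re_inversionDensity] using this
  have hFint : Integrable (𝓕 (fourierMeasure μ)) := by
    have h1 : 𝓕 (fourierMeasure μ) = fun x => inversionDensity μ (-x) := by
      ext x
      rw [inversionDensity, Real.fourierInv_eq_fourier_neg, neg_neg]
    rw [h1]
    exact hdint.comp_neg
  have hinv := congrFun (hcont.fourier_fourierInv_eq (integrable_fourierMeasure h) hFint)
    (-(t / (2 * Real.pi)))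
  have h2 : fourierMeasure μ (-(t / (2 * Real.pi))) = charFun μ t := by
    rw [fourierMeasure]
    congr 1
    field_simp
  rw [← h2, ← hinv, charFun_apply_real,
    integral_withDensity_eq_integral_toReal_smul hc.measurable.ennreal_ofReal (by simp), Real.fourier_eq']
  congr 1 with x
  rw [ENNReal.toReal_ofReal (inversionDensity_nonneg h x), Complex.real_smul,
    ofReal_re_inversionDensity, smul_eq_mul, mul_comm, inversionDensity]
  congr 2
  have : (Real.pi : ℂ) ≠ 0 := by exact_mod_cast Real.pi_ne_zero
  simp
  field_simp

end Inversion

/-! ### Decay of the Bessel function -/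

theorem besselZero_eq_intervalIntegral (x : ℝ) :
    besselZero x = (Real.pi : ℂ)⁻¹ * ∫ u in (0 : ℝ)..Real.pi, Complex.exp (x * Real.cos u * Complex.I) := by
  set g : ℝ → ℂ := fun u => Complex.exp (x * Real.cos u * Complex.I) with hg
  have hint : ∀ a b : ℝ, IntervalIntegrable g volume a b :=
    fun a b => Continuous.intervalIntegrable (by simp only [hg]; fun_prop) a b
  have h1 : besselZero x = ∫ a in (0 : ℝ)..0 + 1, g (2 * Real.pi * a) := by
    rw [besselZero, AddCircle.integral_haarAddCircle, inv_one, one_smul,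
      ← AddCircle.intervalIntegral_preimage 1 0]
    refine intervalIntegral.integral_congr fun a _ => ?_
    simp only [circleCos_coe, hg]
  have hpi : 2 * Real.pi ≠ 0 := by positivity
  have h2 : ∫ u in Real.pi..2 * Real.pi, g u = ∫ u in (0 : ℝ)..Real.pi, g u := by
    have := intervalIntegral.integral_comp_sub_left (a := 0) (b := Real.pi) g (2 * Real.pi)
    rw [sub_zero, show 2 * Real.pi - Real.pi = Real.pi by ring] at this
    rw [← this]
    simp only [hg, Real.cos_two_pi_sub]
  rw [h1, zero_add, intervalIntegral.integral_comp_mul_left g hpi, mul_zero, mul_one,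
    ← intervalIntegral.integral_add_adjacent_intervals (hint 0 Real.pi) (hint Real.pi _), h2,
    Complex.real_smul]
  have : (Real.pi : ℂ) ≠ 0 := by exact_mod_cast Real.pi_ne_zero
  push_cast
  field_simp
  ring

/-- Integration by parts away from the stationary points `0` and `π` of the phase `x cos u`: with `v
= -1 / (i x sin u)` one has `E = E' * v`. The boundary terms and the integral of `‖v'‖` each
contribute at most `2 / (|x| sin δ)`. -/
theorem norm_integral_exp_cos_le {x δ : ℝ} (hx : x ≠ 0) (hδ : 0 < δ) (hδ' : δ ≤ Real.pi / 2) :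
    ‖∫ u in δ..(Real.pi - δ), Complex.exp (x * Real.cos u * Complex.I)‖ ≤
      4 / (|x| * Real.sin δ) := by
  have hle : δ ≤ Real.pi - δ := by linarith
  have hsin : ∀ u ∈ Set.uIcc δ (Real.pi - δ), 0 < Real.sin u := by
    intro u hu
    rw [Set.uIcc_of_le hle] at hu
    exact Real.sin_pos_of_pos_of_lt_pi (by linarith [hu.1]) (by linarith [hu.2])
  have hsδ : 0 < Real.sin δ := hsin δ Set.left_mem_uIcc
  have hxI : (x : ℂ) * Complex.I ≠ 0 := mul_ne_zero (by exact_mod_cast hx) Complex.I_ne_zero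
  set E : ℝ → ℂ := fun u => Complex.exp (x * Real.cos u * Complex.I) with hE
  set v : ℝ → ℂ := fun u => -((x : ℂ) * Complex.I)⁻¹ * (((Real.sin u)⁻¹ : ℝ) : ℂ) with hv
  set v' : ℝ → ℂ := fun u => -((x : ℂ) * Complex.I)⁻¹ * ((-Real.cos u / Real.sin u ^ 2 : ℝ) : ℂ) with hv'
  set E' : ℝ → ℂ := fun u => E u * (x * (-Real.sin u : ℝ) * Complex.I) with hE'
  have hEnorm : ∀ u, ‖E u‖ = 1 := by
    intro u
    rw [hE]
    simp only
    rw [← Complex.ofReal_mul, Complex.norm_exp_ofReal_mul_I]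
  have hdE : ∀ u ∈ Set.uIcc δ (Real.pi - δ), HasDerivAt E (E' u) u := by
    intro u _
    exact (((Real.hasDerivAt_cos u).ofReal_comp.const_mul (x : ℂ)).mul_const Complex.I).cexp
  have hdv : ∀ u ∈ Set.uIcc δ (Real.pi - δ), HasDerivAt v (v' u) u := by
    intro u hu
    exact (((Real.hasDerivAt_sin u).inv (hsin u hu).ne').ofReal_comp).const_mul _
  have hcE' : ContinuousOn E' (Set.uIcc δ (Real.pi - δ)) := by
    apply Continuous.continuousOn
    simp only [hE', hE]
    fun_prop
  have hcr : ContinuousOn (fun u => -Real.cos u / Real.sin u ^ 2) (Set.uIcc δ (Real.pi - δ)) :=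
    Real.continuous_cos.neg.continuousOn.div (Real.continuous_sin.pow 2).continuousOn
      fun u hu => (pow_pos (hsin u hu) 2).ne'
  have hcv' : ContinuousOn v' (Set.uIcc δ (Real.pi - δ)) :=
    continuousOn_const.mul (Complex.continuous_ofReal.comp_continuousOn hcr)
  have hparts := intervalIntegral.integral_deriv_mul_eq_sub hdE hdv
    hcE'.intervalIntegrable hcv'.intervalIntegrable
  have hEv : ∀ u ∈ Set.uIcc δ (Real.pi - δ), E' u * v u = E u := by
    intro u hu
    have h1 : Complex.sin u ≠ 0 := by
      rw [← Complex.ofReal_sin]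
      exact_mod_cast (hsin u hu).ne'
    have h2 : (x : ℂ) ≠ 0 := by exact_mod_cast hx
    simp only [hE', hv]
    push_cast
    field_simp
  have hEvint : ∫ u in δ..(Real.pi - δ), (E' u * v u + E u * v' u) =
      (∫ u in δ..(Real.pi - δ), E u) + ∫ u in δ..(Real.pi - δ), E u * v' u := by
    rw [← intervalIntegral.integral_add]
    · exact intervalIntegral.integral_congr fun u hu => by rw [hEv u hu]
    · exact (Continuous.intervalIntegrable (by simp only [hE]; fun_prop) _ _)
    · refine ContinuousOn.intervalIntegrable (ContinuousOn.mul ?_ hcv')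
      apply Continuous.continuousOn
      simp only [hE]
      fun_prop
  rw [hEvint] at hparts
  have hnc : ‖-((x : ℂ) * Complex.I)⁻¹‖ = |x|⁻¹ := by simp
  have hvn : ∀ u, ‖E u * v u‖ = |x|⁻¹ * |Real.sin u|⁻¹ := by
    intro u
    rw [norm_mul, hEnorm, one_mul, hv]
    simp only
    rw [norm_mul, hnc, Complex.norm_real, norm_inv, Real.norm_eq_abs]
  have hb1 : ‖E (Real.pi - δ) * v (Real.pi - δ) - E δ * v δ‖ ≤ 2 / (|x| * Real.sin δ) := by
    refine (norm_sub_le _ _).trans ?_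
    rw [hvn, hvn, Real.sin_pi_sub, abs_of_pos hsδ]
    apply le_of_eq
    field_simp
    norm_num
  have hb2 : ‖∫ u in δ..(Real.pi - δ), E u * v' u‖ ≤ 2 / (|x| * Real.sin δ) := by
    -- `|cos u| / sin² u` is bounded by `1 / sin² u`, whose antiderivative is `-cot u`.
    have hcot : ∀ u ∈ Set.uIcc δ (Real.pi - δ),
        HasDerivAt (fun u => -(Real.cos u / Real.sin u)) (1 / Real.sin u ^ 2) u := by
      intro u hu
      have h1 := ((Real.hasDerivAt_cos u).div (Real.hasDerivAt_sin u) (hsin u hu).ne').neg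
      have h2 : -((-Real.sin u * Real.sin u - Real.cos u * Real.cos u) / Real.sin u ^ 2) =
          1 / Real.sin u ^ 2 := by
        rw [← neg_div, ← Real.sin_sq_add_cos_sq u]
        ring
      rw [h2] at h1
      exact h1
    have hcsq : ContinuousOn (fun u => 1 / Real.sin u ^ 2) (Set.uIcc δ (Real.pi - δ)) :=
      continuousOn_const.div (Real.continuous_sin.pow 2).continuousOn
        fun u hu => (pow_pos (hsin u hu) 2).ne'
    have hI := intervalIntegral.integral_eq_sub_of_hasDerivAt hcot hcsq.intervalIntegrable
    have h2 : ‖∫ u in δ..(Real.pi - δ), E u * v' u‖ ≤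
        ∫ u in δ..(Real.pi - δ), |x|⁻¹ * (1 / Real.sin u ^ 2) := by
      refine intervalIntegral.norm_integral_le_of_norm_le hle (ae_of_all _ fun u hu => ?_)
        (hcsq.intervalIntegrable.const_mul _)
      have hu' : 0 < Real.sin u := hsin u (by
        rw [Set.uIcc_of_le hle]; exact Set.Ioc_subset_Icc_self hu)
      rw [norm_mul, hEnorm, one_mul, hv']
      simp only
      rw [norm_mul, hnc, Complex.norm_real, Real.norm_eq_abs, abs_div, abs_neg,
        abs_of_pos (pow_pos hu' 2)]
      gcongr
      exact Real.abs_cos_le_one u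
    refine h2.trans ?_
    rw [intervalIntegral.integral_const_mul, hI, Real.sin_pi_sub, Real.cos_pi_sub]
    rw [show -(-Real.cos δ / Real.sin δ) - -(Real.cos δ / Real.sin δ) =
      2 * Real.cos δ / Real.sin δ by ring]
    rw [show 2 / (|x| * Real.sin δ) = |x|⁻¹ * (2 * 1 / Real.sin δ) by
      have : |x| ≠ 0 := abs_ne_zero.2 hx
      field_simp]
    gcongr
    exact Real.cos_le_one δ
  have hfinal : ∫ u in δ..(Real.pi - δ), E u = (E (Real.pi - δ) * v (Real.pi - δ) - E δ * v δ) -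
      ∫ u in δ..(Real.pi - δ), E u * v' u := by
    rw [← hparts]
    ring
  rw [hfinal]
  refine (norm_sub_le _ _).trans ((add_le_add hb1 hb2).trans (le_of_eq ?_))
  ring

/-- The cut `δ = |x| ^ (-1 / 2)` balances the two end intervals, estimated by their length `δ`,
against the middle part of size `1 / (|x| δ)`. -/
theorem norm_integral_exp_cos_pi_le {x : ℝ} (hx : 1 ≤ |x|) :
    ‖∫ u in (0 : ℝ)..Real.pi, Complex.exp (x * Real.cos u * Complex.I)‖ ≤
      (2 + 2 * Real.pi) * |x| ^ (-(1 / 2) : ℝ) := by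
  have hx0 : x ≠ 0 := fun h => by simp [h] at hx; linarith
  have hxp : 0 < |x| := by linarith
  set δ : ℝ := |x| ^ (-(1 / 2) : ℝ) with hδ
  have hδ0 : 0 < δ := by positivity
  have hδ1 : δ ≤ 1 := Real.rpow_le_one_of_one_le_of_nonpos hx (by norm_num)
  have hδ2 : δ ≤ Real.pi / 2 := by linarith [Real.pi_gt_three]
  have hδδ : |x| * δ * δ = 1 := by
    have : δ * δ = |x|⁻¹ := by
      rw [hδ, ← Real.rpow_add hxp, ← Real.rpow_neg_one]
      norm_num
    rw [mul_assoc, this, mul_inv_cancel₀ hxp.ne']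
  have hint : ∀ a b : ℝ, IntervalIntegrable
      (fun u : ℝ => Complex.exp (x * Real.cos u * Complex.I)) volume a b :=
    fun a b => Continuous.intervalIntegrable (by fun_prop) a b
  have hshort : ∀ a b : ℝ, ‖∫ u in a..b, Complex.exp (x * Real.cos u * Complex.I)‖ ≤ |b - a| := by
    intro a b
    have := intervalIntegral.norm_integral_le_of_norm_le_const (a := a) (b := b) (C := 1)
      (f := fun u : ℝ => Complex.exp (x * Real.cos u * Complex.I)) fun u _ => by
        rw [← Complex.ofReal_mul, Complex.norm_exp_ofReal_mul_I]
    simpa using this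
  rw [← intervalIntegral.integral_add_adjacent_intervals (hint 0 δ) (hint δ Real.pi),
    ← intervalIntegral.integral_add_adjacent_intervals (hint δ (Real.pi - δ))
      (hint (Real.pi - δ) Real.pi)]
  have h1 := hshort 0 δ
  have h2 := norm_integral_exp_cos_le hx0 hδ0 hδ2
  have h3 := hshort (Real.pi - δ) Real.pi
  rw [sub_zero, abs_of_pos hδ0] at h1
  rw [sub_sub_cancel, abs_of_pos hδ0] at h3
  have h4 : 4 / (|x| * Real.sin δ) ≤ 2 * Real.pi * δ := by
    have hs := Real.mul_le_sin hδ0.le hδ2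
    have hs0 : 0 < Real.sin δ := lt_of_lt_of_le (by positivity) hs
    rw [div_le_iff₀ (by positivity)]
    calc (4 : ℝ) = 2 * Real.pi * δ * (|x| * (2 / Real.pi * δ)) := by
          have := Real.pi_ne_zero
          field_simp
          linarith
      _ ≤ _ := by gcongr
  calc _ ≤ δ + (2 * Real.pi * δ + δ) :=
        (norm_add_le _ _).trans (add_le_add h1 ((norm_add_le _ _).trans
          (add_le_add (h2.trans h4) h3)))
    _ = _ := by ring

theorem exists_norm_besselZero_le :
    ∃ C : ℝ, 0 < C ∧ ∀ x : ℝ, 1 ≤ |x| → ‖besselZero x‖ ≤ C * |x| ^ (-(1 / 2) : ℝ) := by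
  refine ⟨Real.pi⁻¹ * (2 + 2 * Real.pi), by positivity, fun x hx => ?_⟩
  rw [besselZero_eq_intervalIntegral, norm_mul, norm_inv, Complex.norm_real,
    Real.norm_of_nonneg Real.pi_pos.le, mul_assoc]
  exact mul_le_mul_of_nonneg_left (norm_integral_exp_cos_pi_le hx) (by positivity)

theorem norm_besselZero_le_one (x : ℝ) : ‖besselZero x‖ ≤ 1 := by
  have := norm_integral_le_of_norm_le_const (μ := (AddCircle.haarAddCircle : Measure UnitAddCircle))
    (f := fun θ => Complex.exp (x * circleCos θ * Complex.I)) (C := 1) (ae_of_all _ fun θ => by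
      rw [← Complex.ofReal_mul, Complex.norm_exp_ofReal_mul_I])
  simpa [besselZero] using this

theorem continuous_besselZero : Continuous besselZero := by
  have h : besselZero = charFun ((AddCircle.haarAddCircle : Measure UnitAddCircle).map circleCos) := by
    ext x
    rw [charFun_apply_real, integral_map (by fun_prop) (by fun_prop), besselZero]
  rw [h]
  have : IsProbabilityMeasure ((AddCircle.haarAddCircle : Measure UnitAddCircle).map circleCos) :=
    Measure.isProbabilityMeasure_map (by fun_prop)
  exact continuous_charFun

theorem exists_norm_besselZero_mul_le {b : ℝ} (hb : 0 < b) :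
    ∃ D : ℝ, 0 < D ∧ ∀ t : ℝ, ‖besselZero (b * t)‖ ≤ D * (1 + ‖t‖) ^ (-(1 / 2) : ℝ) := by
  obtain ⟨C, hC, hbd⟩ := exists_norm_besselZero_le
  have hm : 0 < min 1 b / 2 := by positivity
  refine ⟨max C 1 * (min 1 b / 2) ^ (-(1 / 2) : ℝ), by positivity, fun t => ?_⟩
  rw [mul_assoc, ← Real.mul_rpow hm.le (by positivity), Real.norm_eq_abs]
  have hpos : 0 < min 1 b / 2 * (1 + |t|) := by positivity
  have hbt : |b * t| = b * |t| := by rw [abs_mul, abs_of_pos hb]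
  have h1 := min_le_left 1 b
  have h2 := min_le_right 1 b
  have h3 : min 1 b * (1 + |t|) ≤ 1 + |b * t| := by
    rw [hbt, mul_add, mul_one]
    exact add_le_add h1 (mul_le_mul_of_nonneg_right h2 (abs_nonneg t))
  rcases le_total 1 |b * t| with h | h
  · refine (hbd _ h).trans (mul_le_mul (le_max_left _ _) ?_ (by positivity) (by positivity))
    exact Real.rpow_le_rpow_of_nonpos hpos (by linarith) (by norm_num)
  · refine (norm_besselZero_le_one _).trans ?_
    refine one_le_mul_of_one_le_of_one_le (le_max_right _ _) ?_
    exact Real.one_le_rpow_of_pos_of_le_one_of_nonpos hpos (by linarith) (by norm_num)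

/-- A product of three Bessel functions is integrable. -/
theorem integrable_prod_besselZero {b : ℕ → ℝ} (hb : ∀ j, 0 < b j) :
    Integrable fun t => ∏ j ∈ Finset.range 3, ‖besselZero (b j * t)‖ := by
  choose D hD hbd using fun j => exists_norm_besselZero_mul_le (hb j)
  -- Each factor is `O(|t| ^ (-1 / 2))`. Three factors give exponent `3 / 2 > 1`, while two would
  -- give only the borderline exponent 1; this is the origin of `M₀ = 3`.
  have hdom : Integrable fun t : ℝ => (D 0 * D 1 * D 2) * (1 + ‖t‖) ^ (-(3 / 2) : ℝ) :=
    (integrable_one_add_norm (by simp; norm_num)).const_mul _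
  refine hdom.mono' (Continuous.aestronglyMeasurable ?_) (ae_of_all _ fun t => ?_)
  · have := continuous_besselZero
    fun_prop
  · rw [Real.norm_of_nonneg (Finset.prod_nonneg fun j _ => norm_nonneg _)]
    have hle : ∏ j ∈ Finset.range 3, ‖besselZero (b j * t)‖ ≤
        ∏ j ∈ Finset.range 3, D j * (1 + ‖t‖) ^ (-(1 / 2) : ℝ) :=
      Finset.prod_le_prod (fun j _ => norm_nonneg _) fun j _ => hbd j t
    refine hle.trans (le_of_eq ?_)
    rw [Finset.prod_mul_distrib, Finset.prod_const, Finset.card_range, ← Real.rpow_natCast,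
      ← Real.rpow_mul (by positivity)]
    simp only [Finset.prod_range_succ, Finset.prod_range_zero, one_mul]
    norm_num

/-! ### Limiting distributions of trigonometric series -/

/-- If all integer relations between the `γ k` involve only `k < K`, then the group generated by
the `γ k` has a basis consisting of a basis of a finitely generated group containing the `γ k`
with `k < K`, together with the `γ k` for `k ≥ K`. -/
theorem exists_independent_frequencies (γ : ℕ → ℝ) (K : ℕ)
    (hK : ∀ n ∈ LinearMap.ker (Finsupp.linearCombination ℤ γ), ∀ k ≥ K, n k = 0) :
    ∃ (r : ℕ) (e : Fin r ⊕ ℕ → ℝ), LinearIndependent ℤ e ∧ (∀ j, e (Sum.inr j) = γ (K + j)) ∧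
      ∀ k < K, ∃ c : Fin r →₀ ℤ, Finsupp.linearCombination ℤ (e ∘ Sum.inl) c = γ k := by
  have hinj : Function.Injective fun j : ℕ => K + j := add_right_injective K
  set V : Submodule ℤ ℝ := Submodule.span ℤ (Set.range fun k : Fin K => γ k) with hV
  have hfin : Module.Finite ℤ V := Module.Finite.span_of_finite ℤ (Set.finite_range _)
  -- A finitely generated subgroup of `ℝ` is torsion-free, hence free.
  let B := Module.finBasis ℤ V
  let v : Fin (Module.finrank ℤ V) → ℝ := fun a => (B a : ℝ)
  let v' : ℕ → ℝ := fun j => γ (K + j)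
  have hv : LinearIndependent ℤ v := B.linearIndependent.map' V.subtype V.ker_subtype
  have hcomb : ∀ l : ℕ →₀ ℤ, Finsupp.linearCombination ℤ γ (l.mapDomain fun j => K + j) =
      Finsupp.linearCombination ℤ v' l := fun l => Finsupp.linearCombination_mapDomain ℤ _ l
  have hv' : LinearIndependent ℤ v' := by
    rw [linearIndependent_iff]
    intro l hl
    ext j
    have := hK (l.mapDomain fun j => K + j) (by rw [LinearMap.mem_ker, hcomb, hl]) (K + j) (by omega)
    rwa [Finsupp.mapDomain_apply hinj] at this
  have hspanv : Submodule.span ℤ (Set.range v) = V := by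
    have : Set.range v = V.subtype '' Set.range B := by
      rw [← Set.range_comp]
      rfl
    rw [this, Submodule.span_image, B.span_eq, Submodule.map_top, Submodule.range_subtype]
  have hdisj : Disjoint (Submodule.span ℤ (Set.range v)) (Submodule.span ℤ (Set.range v')) := by
    rw [hspanv, Submodule.disjoint_def]
    intro x hx hx'
    rw [hV, Finsupp.mem_span_range_iff_exists_finsupp] at hx
    rw [Finsupp.mem_span_range_iff_exists_finsupp] at hx'
    obtain ⟨n, rfl⟩ := hx
    obtain ⟨l, hl⟩ := hx'
    -- An element common to both spans yields a relation whose coordinates beyond `K` are those of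
    -- `-l`, and these vanish by `hK`.
    have hl0 : l = 0 := by
      ext j
      have := hK (n.mapDomain (fun k : Fin K => (k : ℕ)) - l.mapDomain fun j => K + j) (by
        rw [LinearMap.mem_ker, map_sub, hcomb, Finsupp.linearCombination_mapDomain, sub_eq_zero,
          Finsupp.linearCombination_apply, Finsupp.linearCombination_apply, hl]
        rfl) (K + j) (by omega)
      rw [Finsupp.sub_apply, Finsupp.mapDomain_apply hinj, Finsupp.mapDomain_of_notMem_range] at this
      · simpa using this
      · rintro ⟨k, hk⟩
        have := k.2
        simp only at hk
        omega
    rw [← hl, hl0]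
    simp
  refine ⟨_, Sum.elim v v', hv.sum_type hv' hdisj, fun j => rfl, fun k hk => ?_⟩
  have hmem : γ k ∈ V := Submodule.subset_span ⟨⟨k, hk⟩, rfl⟩
  refine ⟨B.repr ⟨γ k, hmem⟩, ?_⟩
  have h1 := congrArg V.subtype (B.linearCombination_repr ⟨γ k, hmem⟩)
  rw [Finsupp.apply_linearCombination] at h1
  exact h1

section Distribution

variable {b γ : ℕ → ℝ} {K : ℕ}

theorem torusChar_mapDomain_inl {α : Type*} (c : α →₀ ℤ) (θ : α ⊕ ℕ → UnitAddCircle) :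
    torusChar (c.mapDomain Sum.inl) θ = torusChar c fun a => θ (Sum.inl a) := by
  rw [torusChar_apply, torusChar_apply]
  exact Finsupp.prod_mapDomain_index_inj Sum.inl_injective

theorem re_torusChar_torusFlow {ι : Type*} (e : ι → ℝ) (n : ι →₀ ℤ) (δ : ℝ) :
    (torusChar n (torusFlow e δ)).re = Real.cos (Finsupp.linearCombination ℤ e n * δ) := by
  rw [torusChar_torusFlow, ← Complex.exp_ofReal_mul_I_re]
  congr 2
  push_cast
  ring

/-- The real part of a character of the torus. -/
noncomputable def torusCos {ι : Type*} (n : ι →₀ ℤ) : C(ι → UnitAddCircle, ℝ) :=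
  ⟨fun θ => (torusChar n θ).re, by fun_prop⟩

theorem norm_torusCos_le {ι : Type*} (n : ι →₀ ℤ) : ‖torusCos n‖ ≤ 1 := by
  refine (ContinuousMap.norm_le _ zero_le_one).2 fun θ => (Complex.abs_re_le_norm _).trans ?_
  rw [torusChar_apply, Finsupp.prod, norm_prod]
  refine Finset.prod_le_one (fun i _ => norm_nonneg _) fun i _ => ?_
  rw [fourier_apply, Circle.norm_coe]

/-- The functions `δ ↦ cos (γ k δ)` as functions on a torus, evaluated along a linear flow. -/
theorem exists_torus_model (γ : ℕ → ℝ) (K : ℕ)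
    (hK : ∀ n ∈ LinearMap.ker (Finsupp.linearCombination ℤ γ), ∀ k ≥ K, n k = 0) :
    ∃ (r : ℕ) (e : Fin r ⊕ ℕ → ℝ) (w : ℕ → C(Fin r ⊕ ℕ → UnitAddCircle, ℝ))
      (u : ℕ → C(Fin r → UnitAddCircle, ℝ)),
      LinearIndependent ℤ e ∧ (∀ k, ‖w k‖ ≤ 1) ∧
      (∀ k δ, w k (torusFlow e δ) = Real.cos (γ k * δ)) ∧
      (∀ j θ, w (K + j) θ = circleCos (θ (Sum.inr j))) ∧
      ∀ k < K, ∀ θ, w k θ = u k fun a => θ (Sum.inl a) := by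
  obtain ⟨r, e, he, htail, hhead⟩ := exists_independent_frequencies γ K hK
  have hhead' : ∀ k, ∃ c : Fin r →₀ ℤ, k < K →
      Finsupp.linearCombination ℤ (e ∘ Sum.inl) c = γ k := by
    intro k
    by_cases hk : k < K
    · obtain ⟨c, hc⟩ := hhead k hk
      exact ⟨c, fun _ => hc⟩
    · exact ⟨0, fun h => absurd h hk⟩
  choose c hc using hhead'
  let n : ℕ → (Fin r ⊕ ℕ →₀ ℤ) := fun k =>
    if k < K then (c k).mapDomain Sum.inl else Finsupp.single (Sum.inr (k - K)) 1
  refine ⟨r, e, fun k => torusCos (n k), fun k => torusCos (c k), he,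
    fun k => norm_torusCos_le _, fun k δ => ?_, fun j θ => ?_, fun k hk θ => ?_⟩
  · refine (re_torusChar_torusFlow e (n k) δ).trans ?_
    congr 2
    by_cases hk : k < K
    · simp only [n, if_pos hk]
      rw [Finsupp.linearCombination_mapDomain]
      exact hc k hk
    · simp only [n, if_neg hk]
      rw [Finsupp.linearCombination_single, one_smul, htail]
      congr 1
      omega
  · have hj : n (K + j) = Finsupp.single (Sum.inr j) 1 := by
      simp only [n, if_neg (by omega : ¬ K + j < K)]
      rw [Nat.add_sub_cancel_left]
    simp only [hj]
    change (torusChar _ θ).re = (fourier 1 (θ (Sum.inr j))).re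
    rw [torusChar_single]
  · simp only [n, if_pos hk]
    change (torusChar _ θ).re = (torusChar _ _).re
    rw [torusChar_mapDomain_inl]

theorem exists_limitingDensity (hb : ∀ k, 0 < b k) (hsum : Summable b)
    (hK : ∀ n ∈ LinearMap.ker (Finsupp.linearCombination ℤ γ), ∀ k ≥ K, n k = 0) :
    ∃ (μ : Measure ℝ) (f : ℝ → ℝ) (ν : ℕ → Measure ℝ) (g : ℕ → ℝ → ℝ),
      IsCesaroDistribution (fun δ => ∑' k, b k * Real.cos (γ k * δ)) μ ∧
      (∀ M, IsCesaroDistribution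
        (fun δ => ∑ k ∈ Finset.range M, b k * Real.cos (γ k * δ)) (ν M)) ∧
      Integrable (charFun μ) ∧ HasContinuousDensity μ f ∧
      (∀ M ≥ K + 3, Integrable (charFun (ν M)) ∧ HasContinuousDensity (ν M) (g M)) ∧
      Tendsto (fun M => ∫ t, ‖charFun (ν M) t - charFun μ t‖) atTop (𝓝 0) ∧
      (f 0 : ℂ) = (1 / (2 * Real.pi)) * ∫ t, charFun μ t ∧
      Tendsto (fun M => g M 0) atTop (𝓝 (f 0)) := by
  obtain ⟨r, e, w, u, he, hw, hflow, htail, hhead⟩ := exists_torus_model γ K hK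
  set P := torusMeasure (Fin r ⊕ ℕ) with hP
  set s : ℕ → C(Fin r ⊕ ℕ → UnitAddCircle, ℝ) := fun M => ∑ k ∈ Finset.range M, b k • w k with hs
  -- Summability of the coefficients gives convergence in the sup norm, so the full series is itself
  -- continuous on the torus and needs no separate limiting argument for its Cesàro distribution.
  have hsummable : Summable fun k => b k • w k := by
    refine Summable.of_norm_bounded hsum fun k => ?_
    rw [norm_smul, Real.norm_of_nonneg (hb k).le]
    exact mul_le_of_le_one_right (hb k).le (hw k)
  set S : C(Fin r ⊕ ℕ → UnitAddCircle, ℝ) := ∑' k, b k • w k with hS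
  have hlim : Tendsto s atTop (𝓝 S) := hsummable.hasSum.tendsto_sum_nat
  have hlim' : ∀ θ, Tendsto (fun M => s M θ) atTop (𝓝 (S θ)) := fun θ =>
    ((continuous_eval_const (F := C(Fin r ⊕ ℕ → UnitAddCircle, ℝ)) θ).tendsto S).comp hlim
  have hs_apply : ∀ M θ, s M θ = ∑ k ∈ Finset.range M, b k * w k θ := by
    intro M θ
    simp [hs, ContinuousMap.sum_apply]
  have hS_apply : ∀ θ, S θ = ∑' k, b k * w k θ := by
    intro θ
    rw [hS, ← ContinuousMap.tsum_apply hsummable]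
    rfl
  have hμ : IsCesaroDistribution (fun δ => ∑' k, b k * Real.cos (γ k * δ)) (P.map S) := by
    have := isCesaroDistribution_comp_torusFlow he S
    simpa only [hS_apply, hflow] using this
  have hν : ∀ M, IsCesaroDistribution
      (fun δ => ∑ k ∈ Finset.range M, b k * Real.cos (γ k * δ)) (P.map (s M)) := by
    intro M
    have := isCesaroDistribution_comp_torusFlow he (s M)
    simpa only [hs_apply, hflow] using this
  have := hμ.1
  have := fun M => (hν M).1
  have hcf : ∀ t, Tendsto (fun M => charFun (P.map (s M)) t) atTop (𝓝 (charFun (P.map S) t)) := by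
    intro t
    have hform : ∀ f : C(Fin r ⊕ ℕ → UnitAddCircle, ℝ),
        charFun (P.map f) t = ∫ θ, Complex.exp (t * f θ * Complex.I) ∂P := fun f => by
      rw [charFun_apply_real, integral_map f.continuous.aemeasurable (by fun_prop)]
    simp_rw [hform]
    refine tendsto_integral_of_dominated_convergence (fun _ => 1)
      (fun M => Continuous.aestronglyMeasurable (by fun_prop)) (integrable_const 1)
      (fun M => ae_of_all _ fun θ => ?_) (ae_of_all _ fun θ => ?_)
    · rw [← Complex.ofReal_mul, Complex.norm_exp_ofReal_mul_I]
    · have h1 : Continuous fun x : ℝ => Complex.exp (t * x * Complex.I) := by fun_prop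
      exact (h1.tendsto _).comp (hlim' θ)
  -- A majorant independent of `M`: the first three tail factors are kept, while the head and the
  -- other tail factors are bounded by 1.
  set Bd : ℝ → ℝ := fun t => ∏ j ∈ Finset.range 3, ‖besselZero (b (K + j) * t)‖ with hBd
  have hBdint : Integrable Bd := integrable_prod_besselZero fun j => hb (K + j)
  have hbound : ∀ M ≥ K + 3, ∀ t, ‖charFun (P.map (s M)) t‖ ≤ Bd t := by
    intro M hM t
    let U : C(Fin r → UnitAddCircle, ℝ) := ∑ k ∈ Finset.range K, b k • u k
    have hsplit : ⇑(s M) = fun θ => U (fun a => θ (Sum.inl a)) +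
        ∑ j ∈ Finset.range (M - K), b (K + j) * circleCos (θ (Sum.inr j)) := by
      ext θ
      have hMK : M = K + (M - K) := by omega
      rw [hs_apply, hMK, Finset.sum_range_add, Nat.add_sub_cancel_left]
      congr 1
      · simp only [U, ContinuousMap.sum_apply, ContinuousMap.smul_apply, smul_eq_mul]
        exact Finset.sum_congr rfl fun k hk => by rw [hhead k (Finset.mem_range.1 hk)]
      · exact Finset.sum_congr rfl fun j _ => by rw [htail]
    rw [hsplit, charFun_head_add_sum U (fun j => b (K + j)) (M - K) t, norm_mul, norm_prod]
    have hp : IsProbabilityMeasure (P.map fun θ => U fun a => θ (Sum.inl a)) :=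
      Measure.isProbabilityMeasure_map (Continuous.aemeasurable (by fun_prop))
    have h1 : ‖charFun (P.map fun θ => U fun a => θ (Sum.inl a)) t‖ ≤ 1 := norm_charFun_le_one t
    have h2 : ∏ j ∈ Finset.range (M - K), ‖besselZero (b (K + j) * t)‖ ≤ Bd t :=
      Finset.prod_le_prod_of_subset_of_le_one (Finset.range_mono (by omega))
        (fun _ _ => norm_nonneg _) (fun _ _ _ => norm_besselZero_le_one _)
    exact (mul_le_of_le_one_left (Finset.prod_nonneg fun j _ => norm_nonneg _) h1).trans h2
  have hboundS : ∀ t, ‖charFun (P.map S) t‖ ≤ Bd t := fun t =>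
    le_of_tendsto (hcf t).norm (by
      filter_upwards [eventually_ge_atTop (K + 3)] with M hM using hbound M hM t)
  have hintν : ∀ M ≥ K + 3, Integrable (charFun (P.map (s M))) := fun M hM =>
    hBdint.mono' measurable_charFun.aestronglyMeasurable (ae_of_all _ (hbound M hM))
  have hintμ : Integrable (charFun (P.map S)) :=
    hBdint.mono' measurable_charFun.aestronglyMeasurable (ae_of_all _ hboundS)
  refine ⟨P.map S, fun x => (inversionDensity (P.map S) x).re, fun M => P.map (s M),
    fun M x => (inversionDensity (P.map (s M)) x).re, hμ, hν, hintμ,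
    hasContinuousDensity_of_integrable_charFun hintμ,
    fun M hM => ⟨hintν M hM, hasContinuousDensity_of_integrable_charFun (hintν M hM)⟩, ?_, ?_, ?_⟩
  · have h := tendsto_integral_filter_of_dominated_convergence (l := atTop) (μ := volume)
      (F := fun M t => ‖charFun (P.map (s M)) t - charFun (P.map S) t‖) (f := fun _ => (0 : ℝ))
      (fun t => 2 * Bd t)
      (Eventually.of_forall fun M =>
        (measurable_charFun.sub measurable_charFun).norm.aestronglyMeasurable)
      (by
        filter_upwards [eventually_ge_atTop (K + 3)] with M hM
        refine ae_of_all _ fun t => ?_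
        rw [norm_norm, two_mul]
        exact (norm_sub_le _ _).trans (add_le_add (hbound M hM t) (hboundS t)))
      (hBdint.const_mul 2)
      (ae_of_all _ fun t => by
        have := (hcf t).sub_const (charFun (P.map S) t)
        rw [sub_self] at this
        simpa using this.norm)
    simpa using h
  · rw [ofReal_re_inversionDensity, inversionDensity_zero]
  · refine (Complex.continuous_re.tendsto _).comp ?_
    simp only [inversionDensity_zero]
    refine Tendsto.const_mul _ ?_
    refine tendsto_integral_filter_of_dominated_convergence Bd
      (Eventually.of_forall fun M => measurable_charFun.aestronglyMeasurable) ?_ hBdint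
      (ae_of_all _ hcf)
    filter_upwards [eventually_ge_atTop (K + 3)] with M hM
    exact ae_of_all _ (hbound M hM)

end Distribution

/-! ### Conclusion for `L(s, χ_d)` and `ζ(s)` -/

theorem SparseZeros.finiteLimitingDensity {F : ℂ → ℂ} (h : SparseZeros F)
    (hrank : Module.rank ℤ (resonanceLattice F) < Cardinal.aleph0) : FiniteLimitingDensity F := by
  obtain ⟨K, hK, hK0⟩ : ∃ K : ℕ, (∀ n ∈ resonanceLattice F, ∀ k ≥ K, n k = 0) ∧
      (resonanceLattice F = ⊥ → K = 0) := by
    -- When there are no relations the head is empty: `K = 0`, so that `K + 3` is the required bound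
    -- `3`.
    by_cases hbot : resonanceLattice F = ⊥
    · refine ⟨0, fun n hn k _ => ?_, fun _ => rfl⟩
      rw [hbot, Submodule.mem_bot] at hn
      simp [hn]
    · obtain ⟨K, hK⟩ := exists_support_bound_of_rank_lt_aleph0 _ hrank
      exact ⟨K, hK, fun h => absurd h hbot⟩
  have hinf := infinite_ordinates_of_support_bound hK
  have hsum := h.summable_coeff hinf
  obtain ⟨μ, f, ν, g, h1, h2, h3, h4, h5, h6, h7, h8⟩ :=
    exists_limitingDensity (h.coeff_pos hinf) hsum hK
  exact ⟨hsum, μ, f, ν, g, K + 3, h1, h2, h3, h4, h5, fun hbot => by rw [hK0 hbot], h6, h7, h8⟩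

/-- The zeta function is the `L`-function of modulus 1; its pole at `1` lies outside the open strip
and is removed by the factor `s (1 - s)`. -/
theorem sparseZeros_riemannZeta : SparseZeros riemannZeta := by
  have h := DirichletCharacter.sparseZeros (1 : DirichletCharacter ℂ 1)
  rwa [DirichletCharacter.LFunction_modOne_eq] at h

/-- If the resonance lattice of the ordinates of `L(s, χ_d)` has finite rank, then the Cesàro
distribution of `S_L` has a finite density at the origin, the limit of the densities of the
truncated sums; and the same for `ζ(s)` and `S_ζ`. -/
theorem mainTheorem10 (d : ℕ) [NeZero d] (hd : 1 < d) (hsq : Squarefree d) :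
    (Module.rank ℤ (resonanceLattice (DirichletCharacter.LFunction (quadChar d))) <
        Cardinal.aleph0 →
      FiniteLimitingDensity (DirichletCharacter.LFunction (quadChar d))) ∧
    (Module.rank ℤ (resonanceLattice riemannZeta) < Cardinal.aleph0 →
      FiniteLimitingDensity riemannZeta) :=
  ⟨(DirichletCharacter.sparseZeros (quadChar d)).finiteLimitingDensity,
    sparseZeros_riemannZeta.finiteLimitingDensity⟩
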